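/- Let $s\ge 2$ and $t\ge 1$ be coprime integers and put $c=\tfrac12(s-1)(t-1)$. Let $\tilde{\mathfrak S}_s$ be the affine symmetric group of degree $s$, i.e. the group of all permutations $w$ of $\mathbb Z$ with $w(m+s)=w(m)+s$ for all $m$ and $w(0)+\dots+w(s-1)=\binom s2$. It is generated by the elements $w_i$ ($i\in\mathbb Z/s\mathbb Z$), where $w_i(m)=m+1$ if $m\equiv i-1$, $w_i(m)=m-1$ if $m\equiv i$, and $w_i(m)=m$ otherwise (congruences modulo $s$). The level $t$ action $w\mapsto\overline w$ of $\tilde{\mathfrak S}_s$ on $\mathbb Z$ is the unique action such that, for all $i\in\mathbb Z/s\mathbb Z$ and $m\in\mathbb Z$, $$\overline{w_i}(m)=\begin{cases}m+t&\text{if }m\equiv(i-1)t-c\pmod s,\\ m-t&\text{if }m\equiv it-c\pmod s,\\ m&\text{otherwise.}\end{cases}$$ The beta-set of a partition $\lambda=(\lambda_1,\lambda_2,\dots)$ is $\mathcal B^\lambda=\{\lambda_i-i : i\ge1\}$. For $w\in\tilde{\mathfrak S}_s$ and a partition $\lambda$ there is a unique partition $\check w\lambda$ with beta-set $\overline w(\mathcal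 B^\lambda)$; this defines the level $t$ action on partitions, which preserves the set of $s$-cores (an $s$-core is a partition none of whose hook lengths equals $s$). For an $s$-core $\lambda$ let $\operatorname{Stab}_{s,t}(\lambda)$ be its stabiliser in $\tilde{\mathfrak S}_s$ under the level $t$ action on the set of $s$-cores. Then there are only finitely many $(s,t)$-cores (partitions that are both $s$-cores and $t$-cores), the group $\operatorname{Stab}_{s,t}(\lambda)$ is finite for each $(s,t)$-core $\lambda$, and $$\sum_{\lambda\text{ an }(s,t)\text{-core}}\frac1{|\operatorname{Stab}_{s,t}(\lambda)|}=\frac{t^{s-1}}{s!}.$$ -/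

import Mathlib

open scoped Nat

namespace AffineCores

/-! ### Sums over residue classes -/

theorem sum_residues {s : ℕ} (d : ℤ → ℤ) (hd : ∀ m, d (m + s) = d m) (σ : ℤ → ℤ)
    (hσ : ∀ a b : ℤ, (s : ℤ) ∣ σ a - σ b → (s : ℤ) ∣ a - b) :
    ∑ i ∈ Finset.range s, d (σ i) = ∑ i ∈ Finset.range s, d i := by
  rcases Nat.eq_zero_or_pos s with rfl | hs
  · simp
  have hs' : (0 : ℤ) < s := by exact_mod_cast hs
  have hper : Function.Periodic d (s : ℤ) := hd
  have hval : ∀ a : ℤ, (((a % s).toNat : ℕ) : ℤ) = a % s := fun a =>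
    Int.toNat_of_nonneg (Int.emod_nonneg _ hs'.ne')
  have hmaps : Set.MapsTo (fun i : ℕ => (σ i % s).toNat) (Finset.range s : Set ℕ)
      (Finset.range s : Set ℕ) := by
    intro i _
    have h1 := Int.emod_lt_of_pos (σ i) hs'
    have h2 := hval (σ i)
    simp only [Finset.coe_range, Set.mem_Iio]
    omega
  have hinj : Set.InjOn (fun i : ℕ => (σ i % s).toNat) (Finset.range s : Set ℕ) := by
    intro i hi j hj hij
    simp only [Finset.coe_range, Set.mem_Iio] at hi hj
    have h1 : σ i % s = σ j % s := by
      rw [← hval (σ i), ← hval (σ j)]; exact congrArg (fun n : ℕ => (n : ℤ)) hij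
    have h2 := hσ i j (Int.ModEq.dvd (Eq.symm h1))
    have h3 : (i : ℤ) - j = 0 := by
      apply Int.eq_zero_of_abs_lt_dvd h2
      rw [abs_lt]; constructor <;> omega
    omega
  refine Finset.sum_nbij (fun i : ℕ => (σ i % s).toNat) hmaps hinj
    (Finset.surjOn_of_injOn_of_card_le _ hmaps hinj le_rfl) ?_
  intro i _
  simp only [hval]
  have := hper.int_mul (σ i / s) (σ i % s)
  rw [← this]
  congr 1
  have h := Int.emod_add_mul_ediv (σ i) s
  rw [mul_comm] at h
  exact h.symm

theorem sum_two_classes {s : ℕ} (hs : 2 ≤ s) (a b : ZMod s) (hab : a ≠ b) (x y : ℤ) :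
    ∑ j ∈ Finset.range s,
      (if ((j : ℤ) : ZMod s) = a then x else if ((j : ℤ) : ZMod s) = b then y else 0) = x + y := by
  have : NeZero s := ⟨by omega⟩
  have key : ∀ (c : ZMod s) (z : ℤ),
      ∑ j ∈ Finset.range s, (if ((j : ℤ) : ZMod s) = c then z else 0) = z := by
    intro c z
    rw [Finset.sum_eq_single c.val]
    · simp
    · intro j hj hne
      rw [if_neg]
      rintro rfl
      apply hne
      rw [Int.cast_natCast, ZMod.val_cast_of_lt (Finset.mem_range.1 hj)]
    · intro h
      exact absurd (Finset.mem_range.2 (ZMod.val_lt c)) h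
  rw [← key a x, ← key b y, ← Finset.sum_add_distrib]
  rw [key a x, key b y]
  refine Finset.sum_congr rfl fun j _ => ?_
  by_cases h1 : ((j : ℤ) : ZMod s) = a
  · have h2 : ((j : ℤ) : ZMod s) ≠ b := by rw [h1]; exact hab
    rw [if_pos h1, if_pos h1, if_neg h2, add_zero]
  · rw [if_neg h1, if_neg h1, zero_add]

/-! ### The affine symmetric group -/

theorem periodic_dvd {s : ℕ} {w : Equiv.Perm ℤ} (hw : ∀ m, w (m + s) = w m + s) (a b : ℤ)
    (h : (s : ℤ) ∣ a - b) : w a - a = w b - b := by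
  obtain ⟨k, hk⟩ := h
  have hper : Function.Periodic (fun m => w m - m) (s : ℤ) := fun m => by
    simp only [hw]; ring
  have := hper.int_mul k b
  rw [← this]
  have : a = b + (k : ℤ) * s := by linarith [mul_comm (s : ℤ) k]
  rw [this]; simp

theorem sum_sub_eq_zero_iff (s : ℕ) (w : ℤ → ℤ) :
    ∑ i ∈ Finset.range s, (w i - i) = 0 ↔ ∑ i ∈ Finset.range s, w i = (s.choose 2 : ℤ) := by
  have : ∑ i ∈ Finset.range s, (i : ℤ) = (s.choose 2 : ℤ) := by
    rw [Nat.choose_two_right, ← Finset.sum_range_id]; push_cast; rfl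
  rw [Finset.sum_sub_distrib, this, sub_eq_zero]

theorem dvd_of_perm {s : ℕ} {w : Equiv.Perm ℤ} (hw : ∀ m, w (m + s) = w m + s) (a b : ℤ)
    (h : (s : ℤ) ∣ w a - w b) : (s : ℤ) ∣ a - b := by
  obtain ⟨k, hk⟩ := h
  have h1 := periodic_dvd hw (b + s * k) b ⟨k, by ring⟩
  have h2 : w (b + s * k) = w a := by linarith
  have := w.injective h2
  exact ⟨k, by linarith⟩

/-- The affine symmetric group of degree `s`: the permutations `w` of `ℤ` with
`w (m + s) = w m + s` for all `m` and `w 0 + ⋯ + w (s - 1) = s.choose 2`. -/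
def AffineSymm (s : ℕ) : Subgroup (Equiv.Perm ℤ) where
  carrier := {w | (∀ m : ℤ, w (m + s) = w m + s) ∧
    ∑ i ∈ Finset.range s, w (i : ℤ) = (s.choose 2 : ℤ)}
  one_mem' := by
    refine ⟨fun m => rfl, ?_⟩
    rw [← sum_sub_eq_zero_iff s (fun m => (1 : Equiv.Perm ℤ) m)]; simp
  mul_mem' := by
    rintro v w ⟨hv, hv'⟩ ⟨hw, hw'⟩
    refine ⟨fun m => by simp [hv, hw], ?_⟩
    rw [← sum_sub_eq_zero_iff s (fun m => v m)] at hv'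
    rw [← sum_sub_eq_zero_iff s (fun m => w m)] at hw'
    rw [← sum_sub_eq_zero_iff s (fun m => (v * w) m)]
    have h := sum_residues (s := s) (fun m => v m - m) (fun m => by simp only [hv]; ring) w
      (dvd_of_perm hw)
    have h2 : ∑ i ∈ Finset.range s, ((v * w) (i : ℤ) - i) =
        ∑ i ∈ Finset.range s, (v (w i) - w i) + ∑ i ∈ Finset.range s, (w (i : ℤ) - i) := by
      rw [← Finset.sum_add_distrib]
      exact Finset.sum_congr rfl fun i _ => by simp
    rw [h2, h, hv', hw', add_zero]
  inv_mem' := by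
    rintro w ⟨hw, hw'⟩
    have hi : ∀ m : ℤ, w⁻¹ (m + s) = w⁻¹ m + s := fun m => by
      rw [Equiv.Perm.inv_eq_iff_eq, hw]; simp
    refine ⟨hi, ?_⟩
    rw [← sum_sub_eq_zero_iff s (fun m => w m)] at hw'
    rw [← sum_sub_eq_zero_iff s (fun m => w⁻¹ m)]
    have h := sum_residues (s := s) (fun m => w m - m) (fun m => by simp only [hw]; ring)
      (fun m => w⁻¹ m) (dvd_of_perm hi)
    have hc : ∀ m : ℤ, w (w⁻¹ m) = m := fun m => w.apply_symm_apply m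
    simp only [hc] at h
    rw [hw'] at h
    rw [← neg_eq_zero, ← Finset.sum_neg_distrib]
    simpa using h

/-- The underlying map of the simple generator with index `i`. -/
def simpleFun (s : ℕ) (i : ZMod s) (m : ℤ) : ℤ :=
  if (m : ZMod s) = i - 1 then m + 1 else if (m : ZMod s) = i then m - 1 else m

theorem sub_one_ne {s : ℕ} (hs : 2 ≤ s) (i : ZMod s) : i - 1 ≠ i := by
  have : Fact (1 < s) := ⟨hs⟩
  intro h
  exact one_ne_zero (sub_eq_self.1 h)

theorem simpleFun_simpleFun {s : ℕ} (hs : 2 ≤ s) (i : ZMod s) (m : ℤ) :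
    simpleFun s i (simpleFun s i m) = m := by
  have h := sub_one_ne hs i
  by_cases h1 : (m : ZMod s) = i - 1
  · have : simpleFun s i m = m + 1 := if_pos h1
    rw [this, simpleFun, if_neg, if_pos] <;> simp [h1, h.symm]
  · by_cases h2 : (m : ZMod s) = i
    · have : simpleFun s i m = m - 1 := by simp [simpleFun, h2, h.symm]
      rw [this, simpleFun, if_pos] <;> simp [h2]
    · have : simpleFun s i m = m := by simp [simpleFun, h1, h2]
      rw [this, this]

/-- The simple generator `w_i` of the affine symmetric group, for `i` in `ℤ / s`. -/
def simpleRefl {s : ℕ} (hs : 2 ≤ s) (i : ZMod s) : AffineSymm s :=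
  ⟨⟨simpleFun s i, simpleFun s i, simpleFun_simpleFun hs i, simpleFun_simpleFun hs i⟩, by
    refine ⟨fun m => ?_, ?_⟩
    · simp only [Equiv.coe_fn_mk, simpleFun]
      push_cast
      simp only [CharP.cast_eq_zero, add_zero]
      split_ifs <;> ring
    · simp only [Equiv.coe_fn_mk]
      rw [← sum_sub_eq_zero_iff s (simpleFun s i)]
      rw [← add_neg_cancel (1 : ℤ), ← sum_two_classes hs (i - 1) i (sub_one_ne hs i)]
      refine Finset.sum_congr rfl fun j _ => ?_
      simp only [simpleFun]
      split_ifs <;> ring⟩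

theorem simpleRefl_apply {s : ℕ} (hs : 2 ≤ s) (i : ZMod s) (m : ℤ) :
    (simpleRefl hs i).1 m =
      if (m : ZMod s) = i - 1 then m + 1 else if (m : ZMod s) = i then m - 1 else m := rfl

theorem eq_one_of_forall_lt {s : ℕ} (hs : 2 ≤ s) (w : AffineSymm s)
    (h : ∀ m : ℤ, w.1 m < w.1 (m + 1)) : w = 1 := by
  have hmono : StrictMono w.1 := strictMono_int_of_lt_succ h
  have hstep : ∀ m : ℤ, w.1 (m + 1) = w.1 m + 1 := by
    intro m
    obtain ⟨k, hk⟩ := w.1.surjective (w.1 m + 1)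
    have h1 : m < k := hmono.lt_iff_lt.1 (by omega)
    have h2 : w.1 (m + 1) ≤ w.1 k := hmono.monotone (by omega)
    have := h m
    omega
  have hall : ∀ m : ℤ, w.1 m = w.1 0 + m := by
    intro m
    induction m using Int.induction_on with
    | zero => simp
    | succ n ih => rw [hstep, ih]; ring
    | pred n ih =>
      have := hstep (-(n : ℤ) - 1)
      rw [sub_add_cancel] at this
      linarith
  have hsum := (sum_sub_eq_zero_iff s (fun m => w.1 m)).2 w.2.2
  have h0 : w.1 0 = 0 := by
    have h1 : ∑ i ∈ Finset.range s, (w.1 (i : ℤ) - i) = s * w.1 0 := by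
      rw [Finset.sum_congr rfl (fun i _ => by rw [hall])]
      simp
    rw [h1] at hsum
    rcases mul_eq_zero.1 hsum with h2 | h2
    · norm_cast at h2; omega
    · exact h2
  ext m
  rw [hall, h0]
  simp

/-- The affine symmetric group is generated by the elements `w_i`. -/
theorem closure_simpleRefl {s : ℕ} (hs : 2 ≤ s) :
    Subgroup.closure (Set.range (simpleRefl hs)) = ⊤ := by
  rw [eq_top_iff]
  rintro w -
  suffices H : ∀ (n : ℕ) (w : AffineSymm s),
      ∑ i ∈ Finset.range s, (w.1 (i : ℤ) - i) ^ 2 ≤ (n : ℤ) →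
      w ∈ Subgroup.closure (Set.range (simpleRefl hs)) from
    H (∑ i ∈ Finset.range s, (w.1 (i : ℤ) - i) ^ 2).toNat w (Int.self_le_toNat _)
  clear w
  intro n
  induction n using Nat.strong_induction_on with
  | _ n ih =>
    intro w hw
    by_cases hd : ∀ m : ℤ, w.1 m < w.1 (m + 1)
    · rw [eq_one_of_forall_lt hs w hd]; exact one_mem _
    push Not at hd
    obtain ⟨m0, hm0⟩ := hd
    have hne : w.1 (m0 + 1) ≠ w.1 m0 := fun h => by
      have := w.1.injective h; omega
    have hlt : w.1 (m0 + 1) < w.1 m0 := lt_of_le_of_ne hm0 hne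
    set i : ZMod s := (m0 : ZMod s) + 1 with hi
    set g := simpleRefl hs i with hg
    have hdiff : ∑ j ∈ Finset.range s, ((w * g).1 (j : ℤ) - j) ^ 2
        - ∑ j ∈ Finset.range s, (w.1 (j : ℤ) - j) ^ 2 =
        ((w.1 (m0 + 1) - m0) ^ 2 - (w.1 m0 - m0) ^ 2) +
        ((w.1 m0 - (m0 + 1)) ^ 2 - (w.1 (m0 + 1) - (m0 + 1)) ^ 2) := by
      rw [← Finset.sum_sub_distrib, ← sum_two_classes hs (i - 1) i (sub_one_ne hs i)]
      refine Finset.sum_congr rfl fun j _ => ?_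
      have hmul : (w * g).1 (j : ℤ) = w.1 (simpleFun s i j) := rfl
      rw [hmul, simpleFun]
      split_ifs with h1 h2
      · have h3 : (s : ℤ) ∣ j - m0 := by
          rw [← ZMod.intCast_eq_intCast_iff_dvd_sub]
          rw [h1, hi]; simp
        have h4 := periodic_dvd w.2.1 j m0 h3
        have h5 := periodic_dvd w.2.1 (j + 1) (m0 + 1) (by simpa using h3)
        have h6 : w.1 (j + 1) - j = w.1 (m0 + 1) - m0 := by linarith
        rw [h4, h6]
      · have h3 : (s : ℤ) ∣ j - (m0 + 1) := by
          rw [← ZMod.intCast_eq_intCast_iff_dvd_sub]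
          rw [h2, hi]; simp
        have h4 := periodic_dvd w.2.1 j (m0 + 1) h3
        have h5 := periodic_dvd w.2.1 (j - 1) m0
          (by have : (j : ℤ) - 1 - m0 = j - (m0 + 1) := by ring
              rwa [this])
        have h6 : w.1 (j - 1) - j = w.1 m0 - (m0 + 1) := by linarith
        rw [h4, h6]
      · ring
    have hnn : 0 ≤ ∑ j ∈ Finset.range s, ((w * g).1 (j : ℤ) - j) ^ 2 :=
      Finset.sum_nonneg fun _ _ => sq_nonneg _
    have hlt' : ∑ j ∈ Finset.range s, ((w * g).1 (j : ℤ) - j) ^ 2 < n := by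
      nlinarith
    have hmem := ih (∑ j ∈ Finset.range s, ((w * g).1 (j : ℤ) - j) ^ 2).toNat (by omega) (w * g)
      (Int.self_le_toNat _)
    have hgm : g ∈ Subgroup.closure (Set.range (simpleRefl hs)) :=
      Subgroup.subset_closure ⟨i, rfl⟩
    have := mul_mem hmem (inv_mem hgm)
    simpa using this

/-! ### The level `t` action on the integers -/

/-- The integer `(s - 1) (t - 1) / 2`; the division is exact for coprime positive `s` and `t`. -/
def halfProd (s t : ℕ) : ℤ := ((s : ℤ) - 1) * ((t : ℤ) - 1) / 2

/-- The underlying map of the level `t` action of `w` on `ℤ`: it sends `m` to `m + t (w i - i)`,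
where `i` is an integer with `i t ≡ m + halfProd s t` modulo `s` (here `Nat.gcdB s t` is an inverse
of `t` modulo `s`). -/
def levelFun (s t : ℕ) (w : Equiv.Perm ℤ) (m : ℤ) : ℤ :=
  m + t * (w ((m + halfProd s t) * Nat.gcdB s t) - (m + halfProd s t) * Nat.gcdB s t)

theorem bezout {s t : ℕ} (hst : s.Coprime t) :
    (s : ℤ) * Nat.gcdA s t + t * Nat.gcdB s t = 1 := by
  rw [← Nat.gcd_eq_gcd_ab, hst]; rfl

theorem exists_rep {s t : ℕ} (hst : s.Coprime t) (m : ℤ) :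
    ∃ i k : ℤ, m = t * i - halfProd s t + s * k := by
  refine ⟨Nat.gcdB s t * (m + halfProd s t), Nat.gcdA s t * (m + halfProd s t), ?_⟩
  linear_combination (-(m + halfProd s t)) * bezout hst

theorem levelFun_rep {s t : ℕ} (hst : s.Coprime t) {w : Equiv.Perm ℤ}
    (hw : ∀ m : ℤ, w (m + s) = w m + s) (i k : ℤ) :
    levelFun s t w (t * i - halfProd s t + s * k) = t * w i - halfProd s t + s * k := by
  have h := periodic_dvd hw
    ((t * i - halfProd s t + s * k + halfProd s t) * Nat.gcdB s t) i
    ⟨k * Nat.gcdB s t - i * Nat.gcdA s t, by linear_combination i * bezout hst⟩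
  rw [levelFun, h]; ring

theorem levelFun_mul {s t : ℕ} (hst : s.Coprime t) (v w : AffineSymm s) (m : ℤ) :
    levelFun s t v.1 (levelFun s t w.1 m) = levelFun s t (v * w).1 m := by
  obtain ⟨i, k, rfl⟩ := exists_rep hst m
  rw [levelFun_rep hst w.2.1, levelFun_rep hst v.2.1, levelFun_rep hst (v * w).2.1]
  rfl

theorem levelFun_one {s t : ℕ} (m : ℤ) : levelFun s t (1 : AffineSymm s).1 m = m := by
  simp [levelFun]

/-- The level `t` action of the affine symmetric group of degree `s` on `ℤ`. By
`levelAction_simpleRefl` and `levelAction_unique` below, it is the unique action in which each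
simple generator acts by the defining formula. -/
def levelAction {s t : ℕ} (hst : s.Coprime t) : AffineSymm s →* Equiv.Perm ℤ where
  toFun w := ⟨levelFun s t w.1, levelFun s t (w⁻¹).1,
    fun m => by rw [levelFun_mul hst, inv_mul_cancel, levelFun_one],
    fun m => by rw [levelFun_mul hst, mul_inv_cancel, levelFun_one]⟩
  map_one' := Equiv.ext fun m => levelFun_one m
  map_mul' v w := Equiv.ext fun m => (levelFun_mul hst v w m).symm

/-- The simple generator with index `i` adds `t` to the integers in the class
`(i - 1) t - halfProd s t`, subtracts `t` from those in the class `i t - halfProd s t`, and fixes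
all others. -/
theorem levelAction_simpleRefl {s t : ℕ} (hs : 2 ≤ s) (hst : s.Coprime t) (i : ZMod s) (m : ℤ) :
    levelAction hst (simpleRefl hs i) m =
      if (m : ZMod s) = (i - 1) * t - (halfProd s t : ℤ) then m + t
      else if (m : ZMod s) = i * t - (halfProd s t : ℤ) then m - t else m := by
  obtain ⟨j, k, rfl⟩ := exists_rep hst m
  have hu : IsUnit (t : ZMod s) := (ZMod.isUnit_iff_coprime t s).2 hst.symm
  have key : ∀ a : ZMod s, (((t * j - halfProd s t + s * k : ℤ)) : ZMod s) =
      a * t - (halfProd s t : ℤ) ↔ (j : ZMod s) = a := by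
    intro a
    push_cast
    simp only [CharP.cast_eq_zero, zero_mul, add_zero, sub_left_inj]
    rw [mul_comm, hu.mul_left_inj]
  have h1 : levelAction hst (simpleRefl hs i) (t * j - halfProd s t + s * k) =
      t * (simpleRefl hs i).1 j - halfProd s t + s * k :=
    levelFun_rep hst (simpleRefl hs i).2.1 j k
  rw [h1, simpleRefl_apply]
  simp only [key]
  split_ifs <;> ring

theorem levelAction_unique {s t : ℕ} (hs : 2 ≤ s) (hst : s.Coprime t)
    (ρ : AffineSymm s →* Equiv.Perm ℤ)
    (hρ : ∀ (i : ZMod s) (m : ℤ), ρ (simpleRefl hs i) m =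
      if (m : ZMod s) = (i - 1) * t - (halfProd s t : ℤ) then m + t
      else if (m : ZMod s) = i * t - (halfProd s t : ℤ) then m - t else m) :
    ρ = levelAction hst := by
  refine MonoidHom.eq_of_eqOn_dense (closure_simpleRefl hs) ?_
  rintro _ ⟨i, rfl⟩
  ext m
  rw [hρ, levelAction_simpleRefl]

theorem levelAction_mem {s t : ℕ} (hst : s.Coprime t) (w : AffineSymm s) :
    levelAction hst w ∈ AffineSymm s := by
  refine ⟨fun m => ?_, ?_⟩
  · obtain ⟨i, k, rfl⟩ := exists_rep hst m
    have h1 := levelFun_rep hst w.2.1 i k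
    have h2 := levelFun_rep hst w.2.1 i (k + 1)
    rw [mul_add, mul_one, ← add_assoc] at h2
    exact h2.trans (by rw [← add_assoc, ← h1]; rfl)
  · rw [← sum_sub_eq_zero_iff s (fun m => levelAction hst w m)]
    have h := sum_residues (s := s) (fun m => w.1 m - m) (fun m => by simp only [w.2.1]; ring)
      (fun m => (m + halfProd s t) * Nat.gcdB s t) (by
        rintro a b ⟨k, hk⟩
        exact ⟨Nat.gcdA s t * (a - b) + t * k, by
          linear_combination (t : ℤ) * hk - (a - b) * bezout hst⟩)
    rw [(sum_sub_eq_zero_iff s (fun m => w.1 m)).2 w.2.2] at h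
    have h2 : ∀ i : ℕ, levelAction hst w (i : ℤ) - i =
        t * (w.1 ((i + halfProd s t) * Nat.gcdB s t) - (i + halfProd s t) * Nat.gcdB s t) := by
      intro i
      exact add_sub_cancel_left _ _
    rw [Finset.sum_congr rfl fun i _ => h2 i, ← Finset.mul_sum, h, mul_zero]

/-! ### Partitions, cores and beta-sets

A partition is given by its Young diagram `μ`; rows and columns are numbered from `0`, and
`μ.rowLen i`, `μ.colLen j` are the parts of the partition and of its conjugate. -/

/-- The hook length of the cell `(i, j)` of `μ`: the cell, the cells to its right and the cells
below it. -/
def hookLength (μ : YoungDiagram) (i j : ℕ) : ℕ :=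
  1 + (μ.rowLen i - (j + 1)) + (μ.colLen j - (i + 1))

/-- `μ` is an `s`-core if none of its hook lengths equals `s`. -/
def IsCore (s : ℕ) (μ : YoungDiagram) : Prop :=
  ∀ c ∈ μ, hookLength μ c.1 c.2 ≠ s

/-- The beta-set of `μ`: with parts numbered from `0`, the integers `μ_i - (i + 1)`. -/
def betaSet (μ : YoungDiagram) : Set ℤ :=
  Set.range fun i : ℕ => (μ.rowLen i : ℤ) - ((i : ℤ) + 1)

theorem betaSet_injective : Function.Injective betaSet := by
  intro μ ν h
  have hm : ∀ μ : YoungDiagram, StrictMono fun i : ℕ => ((i : ℤ) + 1) - (μ.rowLen i : ℤ) := by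
    intro μ
    refine strictMono_nat_of_lt_succ fun i => ?_
    have := μ.rowLen_anti i (i + 1) (by omega)
    push_cast
    omega
  have hr : ∀ μ : YoungDiagram,
      Set.range (fun i : ℕ => ((i : ℤ) + 1) - (μ.rowLen i : ℤ)) = Neg.neg '' betaSet μ := by
    intro μ
    rw [betaSet, ← Set.range_comp]
    congr 1
    funext i
    simp
  have h2 := (StrictMono.range_inj (hm μ) (hm ν)).1 (by rw [hr, hr, h])
  ext ⟨i, j⟩
  rw [YoungDiagram.mem_cells, YoungDiagram.mem_cells, YoungDiagram.mem_iff_lt_rowLen,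
    YoungDiagram.mem_iff_lt_rowLen]
  have := congrFun h2 i
  omega

theorem notMem_betaSet_iff (μ : YoungDiagram) (m : ℤ) :
    m ∉ betaSet μ ↔ ∃ j : ℕ, m = j - (μ.colLen j : ℤ) := by
  have hcell : ∀ i j : ℕ, j < μ.rowLen i ↔ i < μ.colLen j := fun i j => by
    rw [← YoungDiagram.mem_iff_lt_rowLen, YoungDiagram.mem_iff_lt_colLen]
  constructor
  · intro hm
    have hex : ∃ i : ℕ, (μ.rowLen i : ℤ) - ((i : ℤ) + 1) ≤ m := by
      refine ⟨(μ.rowLen 0 - m).toNat, ?_⟩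
      have := μ.rowLen_anti 0 (μ.rowLen 0 - m).toNat (by omega)
      omega
    classical
    have hi := Nat.find_spec hex
    have hmin := fun k => Nat.find_min hex (m := k)
    set i := Nat.find hex
    have hne : (μ.rowLen i : ℤ) - ((i : ℤ) + 1) ≠ m := fun h => hm ⟨i, h⟩
    refine ⟨(m + i).toNat, ?_⟩
    have hnot : ¬ i < μ.colLen (m + i).toNat := by
      rw [← hcell]; omega
    have hlast : i ≤ μ.colLen (m + i).toNat := by
      rcases Nat.eq_zero_or_pos i with h0 | h0
      · omega
      · have h1 := hmin (i - 1) (by omega)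
        have h2 := (hcell (i - 1) (m + i).toNat).1 (by push Not at h1; omega)
        omega
    omega
  · rintro ⟨j, rfl⟩ ⟨i, hi⟩
    simp only at hi
    have := hcell i j
    omega

theorem isCore_iff {s : ℕ} (hs : 0 < s) (μ : YoungDiagram) :
    IsCore s μ ↔ ∀ b ∈ betaSet μ, b - s ∈ betaSet μ := by
  have hcell : ∀ i j : ℕ, j < μ.rowLen i ↔ i < μ.colLen j := fun i j => by
    rw [← YoungDiagram.mem_iff_lt_rowLen, YoungDiagram.mem_iff_lt_colLen]
  constructor
  · rintro h _ ⟨i, rfl⟩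
    by_contra hn
    obtain ⟨j, hj⟩ := (notMem_betaSet_iff μ _).1 hn
    simp only at hj
    have hc := hcell i j
    have hlt : j < μ.rowLen i := by omega
    refine h (i, j) (YoungDiagram.mem_iff_lt_rowLen.2 hlt) ?_
    simp only [hookLength]
    omega
  · rintro h ⟨i, j⟩ hij hhook
    have h1 := YoungDiagram.mem_iff_lt_rowLen.1 hij
    have h2 := YoungDiagram.mem_iff_lt_colLen.1 hij
    refine (notMem_betaSet_iff μ (j - (μ.colLen j : ℤ))).2 ⟨j, rfl⟩ ?_
    have hb := h ((μ.rowLen i : ℤ) - ((i : ℤ) + 1)) ⟨i, rfl⟩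
    simp only [hookLength] at hhook
    convert hb using 1
    omega

/-- A set of integers that contains all `m < -N` and has exactly `N` further elements, for some
natural number `N`. These are exactly the beta-sets of partitions. -/
def IsMaya (B : Set ℤ) : Prop :=
  ∃ N : ℕ, (∀ m : ℤ, m < -N → m ∈ B) ∧ (B ∩ Set.Ici (-(N : ℤ))).Finite ∧
    (B ∩ Set.Ici (-(N : ℤ))).ncard = N

theorem IsMaya.exists_ge {B : Set ℤ} (h : IsMaya B) : ∃ N₀ : ℕ, ∀ N ≥ N₀,
    (∀ m : ℤ, m < -N → m ∈ B) ∧ (B ∩ Set.Ici (-(N : ℤ))).Finite ∧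
    (B ∩ Set.Ici (-(N : ℤ))).ncard = N := by
  obtain ⟨N₀, h⟩ := h
  refine ⟨N₀, fun N hN => ?_⟩
  induction N, hN using Nat.le_induction with
  | base => exact h
  | succ N hN ih =>
    obtain ⟨h1, h2, h3⟩ := ih
    have heq : B ∩ Set.Ici (-((N + 1 : ℕ) : ℤ)) =
        insert (-((N + 1 : ℕ) : ℤ)) (B ∩ Set.Ici (-(N : ℤ))) := by
      ext m
      simp only [Set.mem_inter_iff, Set.mem_Ici, Set.mem_insert_iff]
      constructor
      · rintro ⟨hm, hm'⟩
        by_cases hm2 : m = -((N + 1 : ℕ) : ℤ)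
        · exact Or.inl hm2
        · exact Or.inr ⟨hm, by push_cast at *; omega⟩
      · rintro (rfl | ⟨hm, hm'⟩)
        · exact ⟨h1 _ (by push_cast; omega), le_rfl⟩
        · exact ⟨hm, by push_cast; omega⟩
    refine ⟨fun m hm => h1 m (by push_cast at hm; omega), ?_, ?_⟩
    · rw [heq]; exact h2.insert _
    · rw [heq, Set.ncard_insert_of_notMem _ h2, h3]
      simp

theorem isMaya_betaSet (μ : YoungDiagram) : IsMaya (betaSet μ) := by
  have hzero : ∀ i : ℕ, μ.colLen 0 ≤ i → μ.rowLen i = 0 := by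
    intro i hi
    by_contra h
    have := YoungDiagram.mem_iff_lt_colLen.1
      (YoungDiagram.mem_iff_lt_rowLen.2 (Nat.pos_of_ne_zero h))
    omega
  have heq : betaSet μ ∩ Set.Ici (-((μ.colLen 0 : ℕ) : ℤ)) =
      (fun i : ℕ => (μ.rowLen i : ℤ) - ((i : ℤ) + 1)) '' (Finset.range (μ.colLen 0) : Set ℕ) := by
    ext m
    simp only [Set.mem_inter_iff, Set.mem_Ici, Set.mem_image, Finset.coe_range, Set.mem_Iio]
    constructor
    · rintro ⟨⟨i, rfl⟩, hm⟩
      refine ⟨i, ?_, rfl⟩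
      by_contra hi
      have := hzero i (by omega)
      simp only at hm
      omega
    · rintro ⟨i, hi, rfl⟩
      exact ⟨⟨i, rfl⟩, by omega⟩
  refine ⟨μ.colLen 0, fun m hm => ⟨(-m - 1).toNat, ?_⟩, ?_, ?_⟩
  · have := hzero (-m - 1).toNat (by omega)
    simp only [this]
    omega
  · rw [heq]; exact (Finset.finite_toSet _).image _
  · rw [heq, Set.ncard_image_of_injective, Set.ncard_coe_finset, Finset.card_range]
    refine StrictAnti.injective (strictAnti_nat_of_succ_lt fun i => ?_)
    have := μ.rowLen_anti i (i + 1) (by omega)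
    push_cast
    omega

theorem exists_diagram (f : ℕ → ℕ) (hf : Antitone f) (K : ℕ) (hK : ∀ i, K ≤ i → f i = 0) :
    ∃ μ : YoungDiagram, ∀ i, μ.rowLen i = f i := by
  let μ : YoungDiagram :=
    { cells := (Finset.range K ×ˢ Finset.range (f 0)).filter fun c => c.2 < f c.1
      isLowerSet := by
        rintro ⟨a, b⟩ ⟨c, d⟩ hle hab
        obtain ⟨h1, h2⟩ := Prod.mk_le_mk.1 hle
        simp only [Finset.coe_filter, Finset.mem_product, Finset.mem_range,
          Set.mem_ofPred_eq] at hab ⊢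
        have := hf h1
        omega }
  have hmem : ∀ i j : ℕ, (i, j) ∈ μ ↔ j < f i := by
    intro i j
    rw [← YoungDiagram.mem_cells]
    simp only [μ, Finset.mem_filter, Finset.mem_product, Finset.mem_range]
    constructor
    · exact fun h => h.2
    · intro h
      have h1 := hf (Nat.zero_le i)
      refine ⟨⟨?_, by omega⟩, h⟩
      by_contra hi
      have := hK i (by omega)
      omega
  refine ⟨μ, fun i => ?_⟩
  have h1 := (hmem i (f i)).not.2 (lt_irrefl _)
  rw [YoungDiagram.mem_iff_lt_rowLen] at h1
  by_contra hne
  have h2 : f i < μ.rowLen i ∨ μ.rowLen i < f i := by omega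
  rcases h2 with h2 | h2
  · exact h1 h2
  · have := YoungDiagram.mem_iff_lt_rowLen.1 ((hmem i _).2 h2)
    omega

theorem IsMaya.exists_betaSet {B : Set ℤ} (h : IsMaya B) : ∃ μ, betaSet μ = B := by
  classical
  obtain ⟨N, h1, h2, h3⟩ := h
  obtain ⟨M, hM0, hM⟩ : ∃ M : ℤ, 0 ≤ M ∧ ∀ m ∈ B, m ≤ M := by
    obtain ⟨M, hM⟩ := h2.bddAbove
    refine ⟨max M 0, le_max_right _ _, fun m hm => ?_⟩
    by_cases hmN : m < -N
    · exact le_max_of_le_right (by omega)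
    · exact le_max_of_le_left (hM ⟨hm, by simpa using hmN⟩)
  let p : ℕ → Prop := fun n => M - n ∈ B
  have hp : ∀ n : ℕ, M + N < n → p n := fun n hn => h1 _ (by omega)
  have hinf : {n | p n}.Infinite := by
    refine Set.infinite_of_forall_exists_gt fun a => ⟨a + (M + N + 1).toNat, hp _ ?_, ?_⟩ <;> omega
  have hcount : Nat.count p (M + N + 1).toNat = N := by
    rw [Nat.count_eq_card_filter_range, ← h3, ← Set.ncard_coe_finset]
    refine Set.ncard_congr (fun n _ => M - n) ?_ ?_ ?_
    · intro n hn
      simp only [Finset.coe_filter, Finset.mem_range, Set.mem_ofPred_eq] at hn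
      exact ⟨hn.2, by simp only [Set.mem_Ici]; omega⟩
    · intro a b _ _ hab
      omega
    · rintro b ⟨hb, hb'⟩
      have := hM b hb
      simp only [Set.mem_Ici] at hb'
      refine ⟨(M - b).toNat, ?_, by omega⟩
      simp only [Finset.coe_filter, Finset.mem_range, Set.mem_ofPred_eq]
      refine ⟨by omega, ?_⟩
      have : M - ((M - b).toNat : ℤ) = b := by omega
      simpa only [p, this] using hb
  have hcount' : ∀ k : ℕ, Nat.count p ((M + N + 1).toNat + k) = N + k := by
    intro k
    induction k with
    | zero => simpa using hcount
    | succ k ih =>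
      rw [← add_assoc, Nat.count_succ, ih, if_pos (hp _ (by omega))]; ring
  have hnth : ∀ i : ℕ, N ≤ i → (Nat.nth p i : ℤ) = M + 1 + i := by
    intro i hi
    obtain ⟨k, rfl⟩ := Nat.exists_eq_add_of_le hi
    have h4 := Nat.nth_count (p := p) (n := (M + N + 1).toNat + k) (hp _ (by omega))
    rw [hcount'] at h4
    rw [h4]
    push_cast
    omega
  have hstep : ∀ i : ℕ, Nat.nth p i + 1 ≤ Nat.nth p (i + 1) := fun i =>
    Nat.nth_strictMono hinf (Nat.lt_succ_self i)
  have hbd : ∀ i : ℕ, (Nat.nth p i : ℤ) ≤ M + 1 + i := by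
    intro i
    have hk : ∀ k : ℕ, Nat.nth p i + k ≤ Nat.nth p (i + k) := by
      intro k
      induction k with
      | zero => simp
      | succ k ih => have := hstep (i + k); change _ ≤ Nat.nth p (i + k + 1); omega
    have h5 := hk N
    have h6 := hnth (i + N) (by omega)
    push_cast at h6
    omega
  obtain ⟨μ, hμ⟩ := exists_diagram (fun i => (M + 1 + i - Nat.nth p i).toNat)
    (antitone_nat_of_succ_le fun i => by
      have := hstep i
      push_cast
      omega) N
    (fun i hi => by
      have := hnth i hi
      omega)
  refine ⟨μ, ?_⟩
  have hval : ∀ i : ℕ, (μ.rowLen i : ℤ) - ((i : ℤ) + 1) = M - Nat.nth p i := by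
    intro i
    rw [hμ]
    have := hbd i
    omega
  ext m
  constructor
  · rintro ⟨i, rfl⟩
    simp only [hval]
    exact Nat.nth_mem_of_infinite hinf i
  · intro hm
    have h7 := hM m hm
    have h8 : p (M - m).toNat := by
      have : M - ((M - m).toNat : ℤ) = m := by omega
      simpa only [p, this] using hm
    refine ⟨Nat.count p (M - m).toNat, ?_⟩
    simp only [hval, Nat.nth_count h8]
    omega

theorem isMaya_simpleRefl {s : ℕ} (hs : 2 ≤ s) (i : ZMod s) {B : Set ℤ} (h : IsMaya B) :
    IsMaya ((simpleRefl hs i).1 '' B) := by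
  obtain ⟨N₀, h⟩ := h.exists_ge
  obtain ⟨N, hN, hNi⟩ : ∃ N : ℕ, N₀ ≤ N ∧ ((-(N : ℤ) : ℤ) : ZMod s) ≠ i := by
    by_cases h1 : ((-(N₀ : ℤ) : ℤ) : ZMod s) = i
    · refine ⟨N₀ + 1, by omega, fun h2 => sub_one_ne hs i ?_⟩
      have h3 : ((-((N₀ + 1 : ℕ) : ℤ) : ℤ) : ZMod s) = ((-(N₀ : ℤ) : ℤ) : ZMod s) - 1 := by
        push_cast; ring
      rw [h3, h1] at h2
      exact h2
    · exact ⟨N₀, le_rfl, h1⟩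
  obtain ⟨h1, h2, h3⟩ := h N hN
  set g := (simpleRefl hs i).1 with hg
  have hgg : ∀ m, g (g m) = m := simpleFun_simpleFun hs i
  have hge : ∀ m : ℤ, -(N : ℤ) ≤ m → -(N : ℤ) ≤ g m := by
    intro m hm
    rw [hg, simpleRefl_apply]
    split_ifs with h4 h5
    · omega
    · have : m ≠ -(N : ℤ) := by rintro rfl; exact hNi h5
      omega
    · exact hm
  have hge' : ∀ m : ℤ, -(N : ℤ) ≤ g m ↔ -(N : ℤ) ≤ m :=
    fun m => ⟨fun h => by simpa only [hgg] using hge _ h, hge m⟩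
  have heq : g '' B ∩ Set.Ici (-(N : ℤ)) = g '' (B ∩ Set.Ici (-(N : ℤ))) := by
    ext m
    constructor
    · rintro ⟨⟨b, hb, rfl⟩, hm⟩
      exact ⟨b, ⟨hb, (hge' b).1 hm⟩, rfl⟩
    · rintro ⟨b, ⟨hb, hm⟩, rfl⟩
      exact ⟨⟨b, hb, rfl⟩, (hge' b).2 hm⟩
  refine ⟨N, fun m hm => ⟨g m, h1 _ ?_, hgg m⟩, ?_, ?_⟩
  · have := (hge' m).not
    omega
  · rw [heq]; exact h2.image _
  · rw [heq, Set.ncard_image_of_injective _ g.injective, h3]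

theorem isMaya_image {s : ℕ} (hs : 2 ≤ s) (w : AffineSymm s) :
    ∀ B : Set ℤ, IsMaya B ↔ IsMaya (w.1 '' B) := by
  have hmul : ∀ (v w : AffineSymm s) (B : Set ℤ), (v * w).1 '' B = v.1 '' (w.1 '' B) := by
    intro v w B
    rw [← Set.image_comp]
    rfl
  have hone : ∀ B : Set ℤ, (1 : AffineSymm s).1 '' B = B := fun B => by simp
  have hw : w ∈ Subgroup.closure (Set.range (simpleRefl hs)) := by
    rw [closure_simpleRefl hs]; trivial
  induction hw using Subgroup.closure_induction with
  | mem x hx =>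
    obtain ⟨i, rfl⟩ := hx
    intro B
    refine ⟨isMaya_simpleRefl hs i, fun h => ?_⟩
    have h2 := isMaya_simpleRefl hs i h
    rw [← hmul] at h2
    have h3 : simpleRefl hs i * simpleRefl hs i = 1 :=
      Subtype.ext (Equiv.ext fun m => simpleFun_simpleFun hs i m)
    rwa [h3, hone] at h2
  | one => intro B; rw [hone]
  | mul x y _ _ hx hy => intro B; rw [hmul, ← hx, ← hy]
  | inv x _ hx =>
    intro B
    rw [hx (x⁻¹.1 '' B), ← hmul, mul_inv_cancel, hone]

/-! ### The level `t` action on partitions and on cores -/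

theorem exists_levelDiagram {s t : ℕ} (hs : 2 ≤ s) (hst : s.Coprime t) (w : AffineSymm s)
    (μ : YoungDiagram) : ∃ ν : YoungDiagram, betaSet ν = levelAction hst w '' betaSet μ :=
  ((isMaya_image hs ⟨levelAction hst w, levelAction_mem hst w⟩ _).1
    (isMaya_betaSet μ)).exists_betaSet

/-- The level `t` action on partitions: the (unique) partition whose beta-set is the image of the
beta-set of `μ` under the level `t` action of `w` on `ℤ`. -/
noncomputable def levelDiagram {s t : ℕ} (hs : 2 ≤ s) (hst : s.Coprime t) (w : AffineSymm s)
    (μ : YoungDiagram) : YoungDiagram :=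
  (exists_levelDiagram hs hst w μ).choose

theorem betaSet_levelDiagram {s t : ℕ} (hs : 2 ≤ s) (hst : s.Coprime t) (w : AffineSymm s)
    (μ : YoungDiagram) :
    betaSet (levelDiagram hs hst w μ) = levelAction hst w '' betaSet μ :=
  (exists_levelDiagram hs hst w μ).choose_spec

theorem levelDiagram_one {s t : ℕ} (hs : 2 ≤ s) (hst : s.Coprime t) (μ : YoungDiagram) :
    levelDiagram hs hst 1 μ = μ :=
  betaSet_injective (by rw [betaSet_levelDiagram, map_one]; simp)

theorem levelDiagram_mul {s t : ℕ} (hs : 2 ≤ s) (hst : s.Coprime t) (v w : AffineSymm s)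
    (μ : YoungDiagram) :
    levelDiagram hs hst (v * w) μ = levelDiagram hs hst v (levelDiagram hs hst w μ) :=
  betaSet_injective (by
    rw [betaSet_levelDiagram, betaSet_levelDiagram, betaSet_levelDiagram, map_mul,
      ← Set.image_comp]
    rfl)

theorem isCore_levelDiagram {s t : ℕ} (hs : 2 ≤ s) (hst : s.Coprime t) (w : AffineSymm s)
    {μ : YoungDiagram} (h : IsCore s μ) : IsCore s (levelDiagram hs hst w μ) := by
  rw [isCore_iff (by omega)] at h ⊢
  rw [betaSet_levelDiagram]
  rintro _ ⟨b, hb, rfl⟩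
  refine ⟨b - s, h b hb, ?_⟩
  have := (levelAction_mem hst w).1 (b - s)
  rw [sub_add_cancel] at this
  linarith

/-- The set of `s`-cores, as a type. -/
def Core (s : ℕ) : Type := {μ : YoungDiagram // IsCore s μ}

/-- The level `t` action of the affine symmetric group of degree `s` on the set of `s`-cores. -/
noncomputable def levelCore {s t : ℕ} (hs : 2 ≤ s) (hst : s.Coprime t) :
    AffineSymm s →* Equiv.Perm (Core s) where
  toFun w :=
    { toFun := fun l => ⟨levelDiagram hs hst w l.1, isCore_levelDiagram hs hst w l.2⟩
      invFun := fun l => ⟨levelDiagram hs hst w⁻¹ l.1, isCore_levelDiagram hs hst w⁻¹ l.2⟩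
      left_inv := fun l => Subtype.ext (by
        simp only [← levelDiagram_mul, inv_mul_cancel, levelDiagram_one])
      right_inv := fun l => Subtype.ext (by
        simp only [← levelDiagram_mul, mul_inv_cancel, levelDiagram_one]) }
  map_one' := Equiv.ext fun l => Subtype.ext (levelDiagram_one hs hst l.1)
  map_mul' v w := Equiv.ext fun l => Subtype.ext (levelDiagram_mul hs hst v w l.1)

/-- The stabiliser of the `s`-core `l` under the level `t` action. -/
noncomputable def levelStab {s t : ℕ} (hs : 2 ≤ s) (hst : s.Coprime t) (l : Core s) :
    Subgroup (AffineSymm s) :=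
  (MulAction.stabilizer (Equiv.Perm (Core s)) l).comap (levelCore hs hst)

theorem mem_levelStab {s t : ℕ} (hs : 2 ≤ s) (hst : s.Coprime t) (l : Core s)
    (w : AffineSymm s) : w ∈ levelStab hs hst l ↔ levelCore hs hst w l = l := Iff.rfl

end AffineCores

/-! Write `c` for `halfProd s t`. As `t` is invertible modulo `s`, every integer has the form `t i -
c + s n`, with `(i, n)` unique up to `(i + s a, n - t a)`. The beta-set of an `s`-core is closed
under subtracting `s`, so in these coordinates it is `{n < k i}` for a unique `k : ℤ → ℤ` with `k (i
+ s) = k i - t`. Such a `k` comes from a partition exactly when its values on `0, …, s - 1` sum to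
zero (`isMaya_belowSet_iff`); the value of `c` is what makes this constant vanish.

The level `t` action becomes `k ↦ k ∘ w⁻¹` (`chargeFun_levelCore`). Subtracting `t` lowers `i` by
one and keeps `n`, so the core is a `t`-core if and only if `k` is antitone (`isCore_iff_antitone`).
Each orbit contains exactly one antitone function (`exists_antitone`, `comp_eq_of_antitone`), so the
sum over `(s,t)`-cores is a sum over all orbits of `s`-cores.

The translations, that is the kernel of the map onto the permutations of `ZMod s`, act freely on
`s`-cores, and their orbits are the fibres of `k ↦ k mod t`, which maps onto the `t ^ (s - 1)`
zero-sum functions `ZMod s → ZMod t`. Hence the stabiliser of a core is in bijection with that of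
its reduction in a group of order `s!`, and orbit-stabiliser turns the sum into `t ^ (s - 1) / s!`
(`finsum_inv_card_stabilizer`). -/

namespace AffineCores

/-! ### Counting orbits with a free normal subgroup -/

section Counting

variable {G H X Y : Type*} [Group G] [Group H] [MulAction H Y]

/-- The bijection is `ψ` itself. It is injective on the stabiliser because the kernel acts freely.
It is onto because a lift of an element fixing `π x` moves `x` within its fibre, and a kernel
element moves it back. -/
theorem card_stabilizer_eq (ρ : G →* Equiv.Perm X) (ψ : G →* H)
    (hψ : Function.Surjective ψ) (π : X → Y) (hequiv : ∀ g x, π (ρ g x) = ψ g • π x)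
    (htrans : ∀ x x', π x = π x' → ∃ g, ψ g = 1 ∧ ρ g x = x')
    (hfree : ∀ g x, ψ g = 1 → ρ g x = x → g = 1) (x : X) :
    Nonempty ((MulAction.stabilizer (Equiv.Perm X) x).comap ρ ≃ MulAction.stabilizer H (π x)) := by
  have hmem : ∀ g, g ∈ (MulAction.stabilizer (Equiv.Perm X) x).comap ρ ↔ ρ g x = x :=
    fun g => Iff.rfl
  refine ⟨Equiv.ofBijective (fun g => ⟨ψ g.1, ?_⟩) ⟨?_, ?_⟩⟩
  · rw [MulAction.mem_stabilizer_iff, ← hequiv, (hmem _).1 g.2]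
  · rintro ⟨g, hg⟩ ⟨h, hh⟩ heq
    rw [hmem] at hg hh
    have h1 : ψ g = ψ h := congrArg Subtype.val heq
    have h2 : g⁻¹ * h = 1 := hfree _ x (by rw [map_mul, map_inv, h1, inv_mul_cancel]) (by
      rw [map_mul, map_inv, Equiv.Perm.mul_apply, hh, Equiv.Perm.inv_eq_iff_eq, hg])
    exact Subtype.ext (inv_mul_eq_one.1 h2)
  · rintro ⟨h, hh⟩
    obtain ⟨g, rfl⟩ := hψ h
    rw [MulAction.mem_stabilizer_iff, ← hequiv] at hh
    obtain ⟨n, hn, hnx⟩ := htrans _ _ hh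
    refine ⟨⟨n * g, (hmem _).2 (by rw [map_mul, Equiv.Perm.mul_apply, hnx])⟩, Subtype.ext ?_⟩
    simp [hn]

/-- If the kernel of `ψ : G → H` acts freely on `X` with quotient `Y`, and `D` is a set of
representatives of the `G`-orbits on `X`, then the sum over `D` of the inverse orders of the
stabilisers is `|Y| / |H|`. -/
theorem finsum_inv_card_stabilizer [Finite H] [Finite Y] (ρ : G →* Equiv.Perm X) (ψ : G →* H)
    (hψ : Function.Surjective ψ) (π : X → Y) (hπ : Function.Surjective π)
    (hequiv : ∀ g x, π (ρ g x) = ψ g • π x)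
    (htrans : ∀ x x', π x = π x' → ∃ g, ψ g = 1 ∧ ρ g x = x')
    (hfree : ∀ g x, ψ g = 1 → ρ g x = x → g = 1) (D : Set X)
    (hex : ∀ x, ∃ g, ρ g x ∈ D) (huniq : ∀ x ∈ D, ∀ g, ρ g x ∈ D → ρ g x = x) :
    D.Finite ∧ (∀ x : X, Finite ((MulAction.stabilizer (Equiv.Perm X) x).comap ρ)) ∧
    ∑ᶠ x ∈ D, (1 : ℚ) / (Nat.card ((MulAction.stabilizer (Equiv.Perm X) x).comap ρ) : ℚ) =
      (Nat.card Y : ℚ) / (Nat.card H : ℚ) := by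
  classical
  have hst := card_stabilizer_eq ρ ψ hψ π hequiv htrans hfree
  -- `D` is in bijection with the `H`-orbits on `Y`: representatives with images in one `H`-orbit
  -- are, after correction by a kernel element, in one `G`-orbit, hence equal.
  let f : D → MulAction.orbitRel.Quotient H Y := fun x => Quotient.mk'' (π x.1)
  have hf : Function.Bijective f := by
    constructor
    · rintro ⟨x, hx⟩ ⟨x', hx'⟩ heq
      obtain ⟨h, hh⟩ : π x ∈ MulAction.orbit H (π x') := Quotient.exact heq
      obtain ⟨g, rfl⟩ := hψ h
      simp only at hh
      rw [← hequiv] at hh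
      obtain ⟨n, hn, hnx⟩ := htrans _ _ hh
      rw [← Equiv.Perm.mul_apply, ← map_mul] at hnx
      have := huniq x' hx' (n * g) (by rwa [hnx])
      exact Subtype.ext (hnx.symm.trans this)
    · intro ω
      induction ω using Quotient.inductionOn' with
      | h y =>
        obtain ⟨x, rfl⟩ := hπ y
        obtain ⟨g, hg⟩ := hex x
        exact ⟨⟨_, hg⟩, Quotient.sound ⟨ψ g, (hequiv g x).symm⟩⟩
  have hfin : Finite D := Finite.of_injective f hf.1
  refine ⟨hfin, fun x => Finite.of_equiv _ (hst x).some.symm, ?_⟩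
  have := Fintype.ofFinite H
  have := Fintype.ofFinite Y
  have := Fintype.ofFinite D
  have := Fintype.ofFinite (MulAction.orbitRel.Quotient H Y)
  let e := Equiv.ofBijective f hf
  -- Orbit-stabiliser on `Y`, with the images of the elements of `D` as orbit representatives.
  have hcard := MulAction.card_eq_sum_card_group_div_card_stabilizer' H Y
    (show Function.LeftInverse Quotient.mk'' fun ω => π (e.symm ω).1 from e.apply_symm_apply)
  rw [← finsum_set_coe_eq_finsum_mem, finsum_eq_sum_of_fintype, Nat.card_eq_fintype_card (α := Y),
    hcard, Nat.cast_sum, Finset.sum_div]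
  refine Fintype.sum_equiv e _ _ fun x => ?_
  rw [e.symm_apply_apply, Nat.card_congr (hst x).some]
  simp only [← Nat.card_eq_fintype_card]
  rw [Nat.cast_div (Subgroup.card_subgroup_dvd_card _) (Nat.cast_ne_zero.2 Nat.card_pos.ne')]
  have h1 : (Nat.card H : ℚ) ≠ 0 := Nat.cast_ne_zero.2 Nat.card_pos.ne'
  field_simp

end Counting

/-! ### The quotient of the affine symmetric group by its translations -/

theorem sum_range_intCast {s : ℕ} [NeZero s] {M : Type*} [AddCommMonoid M] (f : ZMod s → M) :
    ∑ i ∈ Finset.range s, f ((i : ℤ) : ZMod s) = ∑ x, f x := by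
  refine Finset.sum_bij' (fun i _ => ((i : ℤ) : ZMod s)) (fun x _ => x.val) (by simp)
    (fun x _ => Finset.mem_range.2 (ZMod.val_lt x)) ?_ (by simp) (by simp)
  intro i hi
  rw [Int.cast_natCast, ZMod.val_cast_of_lt (Finset.mem_range.1 hi)]

/-- The map induced on residues by an element of the affine symmetric group. -/
def residueFun (s : ℕ) (w : AffineSymm s) (x : ZMod s) : ZMod s := (w.1 (x.cast : ℤ) : ZMod s)

theorem residueFun_intCast {s : ℕ} (w : AffineSymm s) (m : ℤ) :
    residueFun s w m = (w.1 m : ZMod s) := by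
  have h : (s : ℤ) ∣ ((m : ZMod s).cast : ℤ) - m := by
    rw [← ZMod.intCast_eq_intCast_iff_dvd_sub]; simp
  have := periodic_dvd w.2.1 _ _ h
  rw [residueFun, ZMod.intCast_eq_intCast_iff_dvd_sub]
  obtain ⟨k, hk⟩ := h
  exact ⟨-k, by linarith⟩

/-- The action of the affine symmetric group on residues. -/
def residuePerm (s : ℕ) : AffineSymm s →* Equiv.Perm (ZMod s) where
  toFun w := ⟨residueFun s w, residueFun s w⁻¹,
    fun x => by
      obtain ⟨m, rfl⟩ := ZMod.intCast_surjective x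
      rw [residueFun_intCast, residueFun_intCast]; simp,
    fun x => by
      obtain ⟨m, rfl⟩ := ZMod.intCast_surjective x
      rw [residueFun_intCast, residueFun_intCast]; simp⟩
  map_one' := Equiv.ext fun x => by
    obtain ⟨m, rfl⟩ := ZMod.intCast_surjective x
    exact residueFun_intCast 1 m
  map_mul' v w := Equiv.ext fun x => by
    obtain ⟨m, rfl⟩ := ZMod.intCast_surjective x
    simp [residueFun_intCast]

theorem residuePerm_intCast {s : ℕ} (w : AffineSymm s) (m : ℤ) :
    residuePerm s w m = (w.1 m : ZMod s) := residueFun_intCast w m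

theorem residuePerm_surjective {s : ℕ} [NeZero s] : Function.Surjective (residuePerm s) := by
  intro σ
  have hcast : ∀ (τ : Equiv.Perm (ZMod s)) (m : ℤ),
      ((m + (τ m).val - (m : ZMod s).val : ℤ) : ZMod s) = τ m := by
    intro τ m; simp
  -- The lift of `σ` that preserves each block `[s q, s q + s)`: `m - val m` is the start of the
  -- block containing `m`. Displacements cancel within a block, so the sum condition holds.
  let w : Equiv.Perm ℤ :=
    { toFun := fun m => m + (σ m).val - (m : ZMod s).val
      invFun := fun m => m + (σ⁻¹ m).val - (m : ZMod s).val
      left_inv := fun m => by simp only [hcast]; simp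
      right_inv := fun m => by simp only [hcast]; simp }
  have hw : ∀ m, w m = m + (σ m).val - (m : ZMod s).val := fun m => rfl
  refine ⟨⟨w, fun m => ?_, ?_⟩, ?_⟩
  · simp only [hw]; simp; ring
  · rw [← sum_sub_eq_zero_iff s (fun m => w m)]
    have h1 : ∀ i : ℕ, w i - i = ((σ ((i : ℤ) : ZMod s)).val : ℤ) - (((i : ℤ) : ZMod s).val : ℤ) :=
      fun i => by rw [hw]; ring
    rw [Finset.sum_congr rfl fun i _ => h1 i,
      sum_range_intCast (fun x : ZMod s => ((σ x).val : ℤ) - (x.val : ℤ)), Finset.sum_sub_distrib,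
      Equiv.sum_comp σ (fun x : ZMod s => (x.val : ℤ)), sub_self]
  · ext x
    obtain ⟨m, rfl⟩ := ZMod.intCast_surjective x
    rw [residuePerm_intCast]
    exact hcast σ m

/-- The functions from `ℤ / s` to `ℤ / t` with sum zero. -/
abbrev ZeroSum (s t : ℕ) [NeZero s] : Type := {y : ZMod s → ZMod t // ∑ x, y x = 0}

/-- The shadow modulo `t` of the action `k ↦ k ∘ w⁻¹` on quasi-periodic functions. -/
instance (s t : ℕ) [NeZero s] : MulAction (Equiv.Perm (ZMod s)) (ZeroSum s t) where
  smul σ y := ⟨fun x => y.1 (σ⁻¹ x), by rw [Equiv.sum_comp σ⁻¹ y.1, y.2]⟩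
  one_smul y := rfl
  mul_smul σ τ y := Subtype.ext (funext fun x => by
    change y.1 ((σ * τ)⁻¹ x) = y.1 (τ⁻¹ (σ⁻¹ x)); rw [mul_inv_rev]; rfl)

theorem ZeroSum.smul_apply {s t : ℕ} [NeZero s] (σ : Equiv.Perm (ZMod s)) (y : ZeroSum s t)
    (x : ZMod s) : (σ • y).1 x = y.1 (σ⁻¹ x) := rfl

/-- Zero-sum functions form the kernel of the summation map, which is onto `ZMod t` and so has
kernel of index `t`. -/
theorem card_zeroSum (s t : ℕ) [NeZero s] [NeZero t] :
    Nat.card (ZeroSum s t) = t ^ (s - 1) := by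
  let f : (ZMod s → ZMod t) →+ ZMod t :=
    { toFun := fun y => ∑ x, y x, map_zero' := by simp, map_add' := by simp [Finset.sum_add_distrib] }
  have hsurj : Function.Surjective f := fun a => ⟨Pi.single 0 a, by simp [f]⟩
  have h1 : Nat.card (ZeroSum s t) = Nat.card f.ker := rfl
  have h2 := f.ker.card_mul_index
  rw [AddSubgroup.index_ker, AddMonoidHom.range_eq_top.2 hsurj, AddSubgroup.card_top, ← h1] at h2
  simp only [Nat.card_eq_fintype_card, Fintype.card_fun, ZMod.card] at h2 ⊢
  refine Nat.eq_of_mul_eq_mul_right (NeZero.pos t) (h2.trans ?_)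
  rw [← pow_succ, Nat.sub_add_cancel (NeZero.pos s)]

/-! ### Quasi-periodic functions and the corresponding sets of integers -/

/-- A function `k` with `k (i + s) = k i - t`. -/
def QuasiPeriodic (s t : ℕ) (k : ℤ → ℤ) : Prop := ∀ i, k (i + s) = k i - t

theorem QuasiPeriodic.add_mul {s t : ℕ} {k : ℤ → ℤ} (hk : QuasiPeriodic s t k) (i j : ℤ) :
    k (i + s * j) = k i - t * j := by
  induction j using Int.induction_on with
  | zero => simp
  | succ n ih => rw [mul_add, mul_one, ← add_assoc, hk, ih]; ring
  | pred n ih =>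
    have := hk (i + s * (-(n : ℤ) - 1))
    rw [show i + (s : ℤ) * (-(n : ℤ) - 1) + s = i + s * -(n : ℤ) by ring, ih] at this
    linarith

/-- The set of integers whose part in the class of `t i - halfProd s t` modulo `s` lies below
`t i - halfProd s t + s k i`. -/
def belowSet (s t : ℕ) (k : ℤ → ℤ) : Set ℤ :=
  {m | ∃ i n : ℤ, m = t * i - halfProd s t + s * n ∧ n < k i}

theorem dvd_of_rep_eq {s t : ℕ} (hst : s.Coprime t) {i j n p : ℤ}
    (h : (t : ℤ) * i - halfProd s t + s * n = t * j - halfProd s t + s * p) :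
    (s : ℤ) ∣ i - j := by
  have h1 : (s : ℤ) ∣ t * (i - j) := ⟨p - n, by linarith⟩
  exact (Nat.isCoprime_iff_coprime.2 hst).dvd_of_dvd_mul_left h1

/-- The condition `n < k i` does not depend on the representation: passing from `i` to `i + s a`
lowers both `n` and `k i` by `t a`. -/
theorem mem_belowSet {s t : ℕ} (hs : 0 < s) (hst : s.Coprime t) {k : ℤ → ℤ}
    (hk : QuasiPeriodic s t k) (i n : ℤ) :
    (t : ℤ) * i - halfProd s t + s * n ∈ belowSet s t k ↔ n < k i := by
  constructor
  · rintro ⟨j, p, h, hp⟩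
    obtain ⟨a, ha⟩ := dvd_of_rep_eq hst h
    have hs' : (s : ℤ) ≠ 0 := by exact_mod_cast hs.ne'
    have h1 : n = p - t * a := by
      apply mul_left_cancel₀ hs'
      have : i = j + s * a := by linarith
      subst this
      linarith
    have h2 := hk.add_mul j a
    rw [← ha, add_sub_cancel] at h2
    omega
  · exact fun h => ⟨i, n, rfl, h⟩

theorem two_mul_halfProd {s t : ℕ} (hst : s.Coprime t) :
    2 * halfProd s t = ((s : ℤ) - 1) * ((t : ℤ) - 1) := by
  refine Int.mul_ediv_cancel' ?_
  by_contra h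
  rw [Int.prime_two.dvd_mul] at h
  have h1 : 2 ∣ s := by omega
  have h2 : 2 ∣ t := by omega
  have := Nat.dvd_gcd h1 h2
  rw [hst] at this
  omega

/-- The value of `halfProd` matters here. The remainders modulo `s` run through `0, …, s - 1`, so
summing "remainder plus `s` times quotient" gives `s` times this sum as `s ((s - 1) (t - 1) / 2 -
halfProd s t + N)`. -/
theorem sum_ediv {s t : ℕ} (hs : 0 < s) (hst : s.Coprime t) (N : ℤ) :
    ∑ i ∈ Finset.range s, (((t : ℤ) * i - halfProd s t + N) / s) = N := by
  have hs' : (s : ℤ) ≠ 0 := by exact_mod_cast hs.ne'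
  have h1 := sum_residues (s := s) (fun m => m % s) (fun m => by simp)
    (fun m => (t : ℤ) * m - halfProd s t + N) (by
      rintro a b ⟨x, hx⟩
      exact dvd_of_rep_eq hst (n := 0) (p := x) (by linarith))
  have h2 : ∑ i ∈ Finset.range s, ((i : ℤ) % s) = ∑ i ∈ Finset.range s, (i : ℤ) :=
    Finset.sum_congr rfl fun i hi => Int.emod_eq_of_lt (by omega)
      (by have := Finset.mem_range.1 hi; omega)
  have h3 : (∑ i ∈ Finset.range s, (i : ℤ)) * 2 = s * (s - 1) := by
    have := Finset.sum_range_id_mul_two s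
    zify [hs] at this
    exact this
  have h4 : ∑ i ∈ Finset.range s, (((t : ℤ) * i - halfProd s t + N) % s) +
      s * ∑ i ∈ Finset.range s, (((t : ℤ) * i - halfProd s t + N) / s) =
      t * (∑ i ∈ Finset.range s, (i : ℤ)) - s * halfProd s t + s * N := by
    rw [Finset.mul_sum, ← Finset.sum_add_distrib,
      Finset.sum_congr rfl fun i _ => Int.emod_add_mul_ediv _ _,
      Finset.sum_add_distrib, Finset.sum_sub_distrib, Finset.mul_sum]
    simp
  rw [h1, h2] at h4
  apply mul_left_cancel₀ hs'
  have := two_mul_halfProd hst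
  apply mul_left_cancel₀ (two_ne_zero (α := ℤ))
  linear_combination 2 * h4 + ((t : ℤ) - 1) * h3 - s * this

/-- In the class of index `i`, the elements that are at least `-N` correspond to an interval of `n`
ending before `k i`, of length `k i` plus a quotient; the quotients add up to `N` by `sum_ediv`. -/
theorem card_belowSet {s t : ℕ} (hs : 0 < s) (hst : s.Coprime t) {k : ℤ → ℤ}
    (hk : QuasiPeriodic s t k) : ∃ N₀ : ℕ, ∀ N : ℕ, N₀ ≤ N →
      (∀ m : ℤ, m < -N → m ∈ belowSet s t k) ∧ (belowSet s t k ∩ Set.Ici (-(N : ℤ))).Finite ∧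
      ((belowSet s t k ∩ Set.Ici (-(N : ℤ))).ncard : ℤ) = ∑ i ∈ Finset.range s, k i + N := by
  have hs' : (0 : ℤ) < s := by exact_mod_cast hs
  -- For `N ≥ N₀`, the first missing integer of every class is at least `-N`; so nothing below `-N`
  -- is missing and no interval length is negative.
  let N₀ : ℕ := ∑ i ∈ Finset.range s, ((s : ℤ) * k i + (t * i - halfProd s t)).natAbs
  refine ⟨N₀, fun N hN => ?_⟩
  have hN' : ∀ i ∈ Finset.range s, -(N : ℤ) ≤ s * k i + (t * i - halfProd s t) := by
    intro i hi
    have := Finset.single_le_sum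
      (f := fun i : ℕ => ((s : ℤ) * k i + (t * i - halfProd s t)).natAbs) (by simp) hi
    change _ ≤ N₀ at this
    omega
  have hbound : ∀ i n : ℤ, -(N : ℤ) ≤ t * i - halfProd s t + s * n ↔
      -((t * i - halfProd s t + N) / s) ≤ n := by
    intro i n
    rw [neg_le (b := n), Int.le_ediv_iff_mul_le hs']
    constructor <;> intro h <;> linarith
  have hrange : ∀ m : ℤ, ∃ i ∈ Finset.range s, ∃ n : ℤ, m = t * i - halfProd s t + s * n := by
    intro m
    obtain ⟨i, n, rfl⟩ := exists_rep hst m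
    have h1 := Int.emod_nonneg i hs'.ne'
    have h2 := Int.emod_lt_of_pos i hs'
    refine ⟨(i % s).toNat, Finset.mem_range.2 (by omega), n + t * (i / s), ?_⟩
    rw [Int.toNat_of_nonneg h1]
    linear_combination (-(t : ℤ)) * Int.emod_add_mul_ediv i s
  let F := (Finset.range s).sigma
    fun i => Finset.Ico (-(((t : ℤ) * i - halfProd s t + N) / s)) (k i)
  let g : (Σ _ : ℕ, ℤ) → ℤ := fun x => t * x.1 - halfProd s t + s * x.2
  have himage : belowSet s t k ∩ Set.Ici (-(N : ℤ)) = g '' (F : Set (Σ _ : ℕ, ℤ)) := by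
    ext m
    constructor
    · rintro ⟨hm, hm'⟩
      obtain ⟨i, hi, n, rfl⟩ := hrange m
      rw [mem_belowSet hs hst hk] at hm
      refine ⟨⟨i, n⟩, ?_, rfl⟩
      simp only [F, Finset.coe_sigma, Set.mem_sigma_iff, Finset.coe_Ico, Set.mem_Ico]
      exact ⟨hi, (hbound i n).1 hm', hm⟩
    · rintro ⟨⟨i, n⟩, h, rfl⟩
      simp only [F, Finset.coe_sigma, Set.mem_sigma_iff, Finset.coe_Ico, Set.mem_Ico] at h
      exact ⟨(mem_belowSet hs hst hk i n).2 h.2.2, (hbound i n).2 h.2.1⟩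
  have hinj : Set.InjOn g F := by
    rintro ⟨i, n⟩ h ⟨j, p⟩ h' heq
    simp only [F, Finset.coe_sigma, Set.mem_sigma_iff, Finset.coe_range, Set.mem_Iio] at h h'
    have h1 : (i : ℤ) - j = 0 := Int.eq_zero_of_abs_lt_dvd (dvd_of_rep_eq hst heq) (by
      rw [abs_lt]; constructor <;> omega)
    have h2 : i = j := by omega
    subst h2
    have h3 : (s : ℤ) * n = s * p := by simp only [g] at heq; linarith
    rw [mul_left_cancel₀ hs'.ne' h3]
  refine ⟨fun m hm => ?_, ?_, ?_⟩
  · obtain ⟨i, hi, n, rfl⟩ := hrange m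
    rw [mem_belowSet hs hst hk]
    have := hN' i hi
    by_contra hcon
    push Not at hcon
    have := mul_le_mul_of_nonneg_left hcon hs'.le
    linarith
  · rw [himage]; exact (Finset.finite_toSet F).image g
  · rw [himage, hinj.ncard_image, Set.ncard_coe_finset, Finset.card_sigma, Nat.cast_sum]
    have h1 : ∀ i ∈ Finset.range s,
        ((Finset.Ico (-(((t : ℤ) * i - halfProd s t + N) / s)) (k i)).card : ℤ) =
        k i + ((t : ℤ) * i - halfProd s t + N) / s := by
      intro i hi
      rw [Int.card_Ico, Int.toNat_of_nonneg] <;> rw [sub_neg_eq_add]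
      have h2 := (hbound i (k i)).1 (by linarith [hN' i hi])
      linarith
    rw [Finset.sum_congr rfl h1, Finset.sum_add_distrib, sum_ediv hs hst]

theorem isMaya_belowSet_iff {s t : ℕ} (hs : 0 < s) (hst : s.Coprime t) {k : ℤ → ℤ}
    (hk : QuasiPeriodic s t k) :
    IsMaya (belowSet s t k) ↔ ∑ i ∈ Finset.range s, k i = 0 := by
  obtain ⟨N₀, h⟩ := card_belowSet hs hst hk
  constructor
  · intro hm
    obtain ⟨N₁, h'⟩ := hm.exists_ge
    have h1 := (h (max N₀ N₁) (le_max_left _ _)).2.2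
    rw [(h' (max N₀ N₁) (le_max_right _ _)).2.2] at h1
    linarith
  · intro h0
    obtain ⟨h1, h2, h3⟩ := h N₀ le_rfl
    exact ⟨N₀, h1, h2, by rw [h0, zero_add] at h3; exact_mod_cast h3⟩

/-! ### Cores as quasi-periodic functions -/

/-- Each progression `t i - c + s n` meets the beta-set in a set of `n` that is closed downwards,
nonempty and bounded above, hence has a threshold `k i`. Replacing `i` by `i + s` reindexes the same
progression by `n ↦ n + t`, which gives quasi-periodicity. -/
theorem exists_belowSet {s t : ℕ} (hs : 0 < s) (hst : s.Coprime t) {μ : YoungDiagram}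
    (h : IsCore s μ) : ∃ k : ℤ → ℤ, QuasiPeriodic s t k ∧ betaSet μ = belowSet s t k := by
  have hs' : (0 : ℤ) < s := by exact_mod_cast hs
  rw [isCore_iff hs] at h
  obtain ⟨N, h1, h2, -⟩ := isMaya_betaSet μ
  obtain ⟨M, hM⟩ := h2.bddAbove
  have hlt : ∀ i : ℤ, ∃ a : ℤ, ∀ n : ℤ, (t : ℤ) * i - halfProd s t + s * n ∈ betaSet μ ↔ n < a := by
    intro i
    have hdown : ∀ j : ℕ, ∀ n : ℤ, (t : ℤ) * i - halfProd s t + s * n ∈ betaSet μ →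
        (t : ℤ) * i - halfProd s t + s * (n - j) ∈ betaSet μ := by
      intro j n hn
      induction j with
      | zero => simpa using hn
      | succ j ih =>
        convert h _ ih using 1
        push_cast
        ring
    have hbdd : ∃ b : ℤ, ∀ z : ℤ, (t : ℤ) * i - halfProd s t + s * z ∈ betaSet μ → z ≤ b := by
      refine ⟨(max M (-N) - (t * i - halfProd s t)) / s, fun z hz => ?_⟩
      rw [Int.le_ediv_iff_mul_le hs']
      by_cases hzN : (t : ℤ) * i - halfProd s t + s * z < -N
      · have := le_max_right M (-(N : ℤ)); linarith
      · have := hM ⟨hz, by simpa using hzN⟩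
        have := le_max_left M (-(N : ℤ)); linarith
    have hne : ∃ z : ℤ, (t : ℤ) * i - halfProd s t + s * z ∈ betaSet μ := by
      refine ⟨(-N - 1 - (t * i - halfProd s t)) / s, h1 _ ?_⟩
      have := Int.mul_ediv_self_le (x := -N - 1 - (t * i - halfProd s t)) hs'.ne'
      linarith
    obtain ⟨a, ha, hmax⟩ := Int.exists_greatest_of_bdd hbdd hne
    refine ⟨a + 1, fun n => ⟨fun hn => by have := hmax n hn; omega, fun hn => ?_⟩⟩
    have := hdown (a - n).toNat a ha
    rwa [Int.toNat_of_nonneg (by omega), sub_sub_cancel] at this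
  choose k hk using hlt
  refine ⟨k, fun i => ?_, ?_⟩
  · have h3 : ∀ n, n < k (i + s) ↔ n < k i - t := by
      intro n
      rw [← hk, lt_sub_iff_add_lt, ← hk]
      ring_nf
    have h4 := (h3 (k (i + s))).not
    have h5 := (h3 (k i - t)).not
    omega
  · ext m
    constructor
    · intro hm
      obtain ⟨i, n, rfl⟩ := exists_rep hst m
      exact ⟨i, n, rfl, (hk i n).1 hm⟩
    · rintro ⟨i, n, rfl, hn⟩
      exact (hk i n).2 hn

theorem isCore_of_belowSet {s t : ℕ} (hs : 0 < s) {k : ℤ → ℤ} {μ : YoungDiagram}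
    (h : betaSet μ = belowSet s t k) :
    IsCore s μ := by
  rw [isCore_iff hs, h]
  rintro _ ⟨i, n, rfl, hn⟩
  exact ⟨i, n - 1, by ring, by omega⟩

/-- Subtracting `t` from `t i - c + s n` replaces `i` by `i - 1` and keeps `n`, so closure under it
says that `n < k i` implies `n < k (i - 1)`. -/
theorem isCore_iff_antitone {s t : ℕ} (hs : 0 < s) (ht : 0 < t) (hst : s.Coprime t) {k : ℤ → ℤ}
    (hk : QuasiPeriodic s t k) {μ : YoungDiagram} (h : betaSet μ = belowSet s t k) :
    IsCore t μ ↔ ∀ i, k (i + 1) ≤ k i := by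
  rw [isCore_iff ht, h]
  constructor
  · intro hc i
    -- The largest element of the class of index `i + 1`.
    have h1 := hc (t * (i + 1) - halfProd s t + s * (k (i + 1) - 1))
      ((mem_belowSet hs hst hk _ _).2 (by omega))
    rw [show (t : ℤ) * (i + 1) - halfProd s t + s * (k (i + 1) - 1) - t =
      t * i - halfProd s t + s * (k (i + 1) - 1) by ring, mem_belowSet hs hst hk] at h1
    omega
  · rintro hc _ ⟨i, n, rfl, hn⟩
    have := hc (i - 1)
    rw [sub_add_cancel] at this
    exact ⟨i - 1, n, by ring, by omega⟩

theorem belowSet_injective {s t : ℕ} (hs : 0 < s) (hst : s.Coprime t) {k l : ℤ → ℤ}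
    (hk : QuasiPeriodic s t k) (hl : QuasiPeriodic s t l) (h : belowSet s t k = belowSet s t l) :
    k = l := by
  funext i
  have h1 : ∀ n, n < k i ↔ n < l i := fun n => by
    rw [← mem_belowSet hs hst hk, h, mem_belowSet hs hst hl]
  have h2 := (h1 (k i)).not
  have h3 := (h1 (l i)).not
  omega

/-- The action moves the index `i` to `w i` and keeps the coordinate `n`. -/
theorem levelAction_image_belowSet {s t : ℕ} (hst : s.Coprime t) (w : AffineSymm s) (k : ℤ → ℤ) :
    levelAction hst w '' belowSet s t k = belowSet s t (fun i => k (w⁻¹.1 i)) := by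
  ext m
  constructor
  · rintro ⟨_, ⟨i, n, rfl, hn⟩, rfl⟩
    exact ⟨w.1 i, n, levelFun_rep hst w.2.1 i n, by simpa using hn⟩
  · rintro ⟨i, n, rfl, hn⟩
    refine ⟨_, ⟨w⁻¹.1 i, n, rfl, hn⟩, (levelFun_rep hst w.2.1 _ n).trans ?_⟩
    simp

/-! ### Antitone quasi-periodic functions represent the orbits -/

theorem QuasiPeriodic.comp {s t : ℕ} {k : ℤ → ℤ} (hk : QuasiPeriodic s t k) (w : AffineSymm s) :
    QuasiPeriodic s t fun i => k (w.1 i) := fun i => by simp only [w.2.1, hk (w.1 i)]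

/-- Sorting by adjacent swaps. The quantity `s k i + t i` is `s`-periodic in `i`, and swapping at an
ascent `k m < k (m + 1)`, simultaneously at all translates by multiples of `s`, lowers the sum of
its squares over a period by `2 t s (k (m + 1) - k m)`. The sum is a nonnegative integer, so the
process stops. -/
theorem exists_antitone {s t : ℕ} (hs : 2 ≤ s) (ht : 0 < t) {k : ℤ → ℤ}
    (hk : QuasiPeriodic s t k) : ∃ w : AffineSymm s, ∀ i, k (w.1 (i + 1)) ≤ k (w.1 i) := by
  have ht' : (0 : ℤ) < t := by exact_mod_cast ht
  have hs' : (0 : ℤ) < s := by exact_mod_cast (by omega : 0 < s)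
  suffices H : ∀ (n : ℕ) (k : ℤ → ℤ), QuasiPeriodic s t k →
      ∑ i ∈ Finset.range s, (s * k i + t * (i : ℤ)) ^ 2 ≤ (n : ℤ) →
      ∃ w : AffineSymm s, ∀ i, k (w.1 (i + 1)) ≤ k (w.1 i) from
    H (∑ i ∈ Finset.range s, (s * k i + t * (i : ℤ)) ^ 2).toNat k hk (Int.self_le_toNat _)
  clear hk k
  intro n
  induction n using Nat.strong_induction_on with
  | _ n ih =>
    intro k hk hn
    by_cases hd : ∀ i, k (i + 1) ≤ k i
    · exact ⟨1, hd⟩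
    push Not at hd
    obtain ⟨m, hm⟩ := hd
    set i : ZMod s := (m : ZMod s) + 1 with hi
    set g := simpleRefl hs i with hg
    have hper : ∀ a b : ℤ, (s : ℤ) ∣ a - b → s * k a + t * a = s * k b + t * b := by
      rintro a b ⟨c, hc⟩
      have := hk.add_mul b c
      rw [← hc, add_sub_cancel] at this
      rw [this]
      linear_combination (t : ℤ) * hc
    have hdiff : ∑ j ∈ Finset.range s, (s * k (g.1 (j : ℤ)) + t * (j : ℤ)) ^ 2
        - ∑ j ∈ Finset.range s, (s * k (j : ℤ) + t * (j : ℤ)) ^ 2 =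
        ((s * k (m + 1) + t * m) ^ 2 - (s * k m + t * m) ^ 2) +
        ((s * k m + t * (m + 1)) ^ 2 - (s * k (m + 1) + t * (m + 1)) ^ 2) := by
      rw [← Finset.sum_sub_distrib, ← sum_two_classes hs (i - 1) i (sub_one_ne hs i)]
      refine Finset.sum_congr rfl fun j _ => ?_
      rw [hg, simpleRefl_apply]
      split_ifs with h1 h2
      · have h3 : (s : ℤ) ∣ j - m := by
          rw [← ZMod.intCast_eq_intCast_iff_dvd_sub]
          rw [h1, hi]; simp
        have h4 := hper j m h3
        have h5 := hper (j + 1) (m + 1) (by simpa using h3)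
        have h6 : s * k (j + 1) + t * j = s * k (m + 1) + t * m := by linarith
        rw [h4, h6]
      · have h3 : (s : ℤ) ∣ j - (m + 1) := by
          rw [← ZMod.intCast_eq_intCast_iff_dvd_sub]
          rw [h2, hi]; simp
        have h4 := hper j (m + 1) h3
        have h5 := hper (j - 1) m
          (by have : (j : ℤ) - 1 - m = j - (m + 1) := by ring
              rwa [this])
        have h6 : s * k (j - 1) + t * j = s * k m + t * (m + 1) := by linarith
        rw [h4, h6]
      · ring
    have hnn : 0 ≤ ∑ j ∈ Finset.range s, (s * k (g.1 (j : ℤ)) + t * (j : ℤ)) ^ 2 :=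
      Finset.sum_nonneg fun _ _ => sq_nonneg _
    have hlt : ∑ j ∈ Finset.range s, (s * k (g.1 (j : ℤ)) + t * (j : ℤ)) ^ 2 < n := by
      have : (0 : ℤ) < t * s * (k (m + 1) - k m) :=
        mul_pos (mul_pos ht' hs') (by linarith)
      linarith
    obtain ⟨w, hw⟩ := ih _ (by omega) _ (hk.comp g) (Int.self_le_toNat _)
    exact ⟨g * w, hw⟩

/-- Comparing the hypothesis at `m` and `m + s`, `w` carries the block `[a - s, a)` onto `[b - s,
b)`. Its total displacement there is `s (b - a)`, but the total over any `s` consecutive integers is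
zero. -/
theorem eq_of_image_Iio {s : ℕ} (hs : 0 < s) (w : AffineSymm s) {a b : ℤ}
    (h : ∀ m, w.1 m < b ↔ m < a) : a = b := by
  have hs' : (s : ℤ) ≠ 0 := by exact_mod_cast hs.ne'
  have hsum : ∑ i ∈ Finset.range s, (w.1 (a - s + i) - (a - s + i)) = 0 := by
    rw [sum_residues (s := s) (fun m => w.1 m - m) (fun m => by simp only [w.2.1]; ring)
      (fun m => a - s + m) (fun x y h => by simpa using h)]
    exact (sum_sub_eq_zero_iff s (fun m => w.1 m)).2 w.2.2
  have hIco : ∀ c : ℤ, ∀ f : ℤ → ℤ,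
      ∑ i ∈ Finset.range s, f (c - s + i) = ∑ m ∈ Finset.Ico (c - s) c, f m := by
    intro c f
    refine Finset.sum_nbij' (fun i => c - s + (i : ℤ)) (fun m => (m - (c - s)).toNat) ?_ ?_ ?_ ?_ ?_
    all_goals intro x hx
    all_goals simp only [Finset.mem_range, Finset.mem_Ico] at hx ⊢
    all_goals omega
  have hmove : ∑ m ∈ Finset.Ico (a - s) a, w.1 m = ∑ m ∈ Finset.Ico (b - s) b, m := by
    refine Finset.sum_equiv w.1 (fun m => ?_) fun _ _ => rfl
    have h1 := h m
    have h2 := h (m + s)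
    rw [w.2.1] at h2
    simp only [Finset.mem_Ico]
    omega
  rw [Finset.sum_sub_distrib, hIco a (fun m => w.1 m), hmove, ← hIco b (fun m => m),
    ← Finset.sum_sub_distrib] at hsum
  have h1 : ∀ i ∈ Finset.range s, b - s + (i : ℤ) - (a - s + i) = b - a := fun i _ => by ring
  rw [Finset.sum_congr rfl h1, Finset.sum_const, Finset.card_range, nsmul_eq_mul] at hsum
  have := (mul_eq_zero.1 hsum).resolve_left hs'
  linarith

/-- As `t > 0`, quasi-periodicity makes `k` unbounded in both directions, so each superlevel set of
an antitone `k` is a proper nonempty ray. -/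
theorem exists_lt_iff_of_antitone {s t : ℕ} (ht : 0 < t) {k : ℤ → ℤ}
    (hk : QuasiPeriodic s t k) (hanti : Antitone k) (n : ℤ) : ∃ a, ∀ i, i < a ↔ n < k i := by
  have hsmall : ∀ x : ℤ, ∃ i, k i ≤ x := by
    intro x
    refine ⟨0 + s * (k 0 - x).natAbs, ?_⟩
    rw [hk.add_mul]
    have : ((k 0 - x).natAbs : ℤ) ≤ t * (k 0 - x).natAbs :=
      le_mul_of_one_le_left (by omega) (by omega)
    omega
  have hlarge : ∀ x : ℤ, ∃ i, x ≤ k i := by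
    intro x
    refine ⟨0 + s * (-(x - k 0).natAbs : ℤ), ?_⟩
    rw [hk.add_mul]
    have : ((x - k 0).natAbs : ℤ) ≤ t * (x - k 0).natAbs :=
      le_mul_of_one_le_left (by omega) (by omega)
    rw [mul_neg]
    omega
  obtain ⟨j, hj⟩ := hlarge (n + 1)
  obtain ⟨j', hj'⟩ := hsmall n
  obtain ⟨a, ha, hmax⟩ := Int.exists_greatest_of_bdd (P := fun i => n < k i)
    ⟨j', fun i hi => by
      by_contra hcon
      push Not at hcon
      have := hanti hcon.le
      omega⟩ ⟨j, by omega⟩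
  refine ⟨a + 1, fun i => ⟨fun hi => ha.trans_le (hanti (by omega)), fun hi => ?_⟩⟩
  have := hmax i hi
  omega

/-- A function is determined by its superlevel sets. Those of `k ∘ w` and `k` at the same level are
rays, the first carried onto the second by `w`, so they coincide by `eq_of_image_Iio`. -/
theorem comp_eq_of_antitone {s t : ℕ} (hs : 0 < s) (ht : 0 < t) {k : ℤ → ℤ}
    (hk : QuasiPeriodic s t k) (w : AffineSymm s) (h : Antitone k)
    (hw : Antitone fun i => k (w.1 i)) : (fun i => k (w.1 i)) = k := by
  have key : ∀ i n, n < k (w.1 i) ↔ n < k i := by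
    intro i n
    obtain ⟨a, ha⟩ := exists_lt_iff_of_antitone ht (hk.comp w) hw n
    obtain ⟨b, hb⟩ := exists_lt_iff_of_antitone ht hk h n
    have := eq_of_image_Iio hs w (a := a) (b := b) fun m => by rw [hb, ha]
    rw [← hb i, ← this, ha]
  funext i
  have h1 := (key i (k i)).not
  have h2 := (key i (k (w.1 i))).not
  omega

/-! ### The quasi-periodic function of a core -/

section Charge

variable {s t : ℕ} (hs : 2 ≤ s) (hst : s.Coprime t)

/-- The quasi-periodic function of an `s`-core. -/
noncomputable def chargeFun (l : Core s) : ℤ → ℤ :=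
  (exists_belowSet (by omega) hst l.2).choose

theorem chargeFun_quasiPeriodic (l : Core s) : QuasiPeriodic s t (chargeFun hs hst l) :=
  (exists_belowSet (by omega) hst l.2).choose_spec.1

theorem betaSet_eq_belowSet (l : Core s) : betaSet l.1 = belowSet s t (chargeFun hs hst l) :=
  (exists_belowSet (by omega) hst l.2).choose_spec.2

theorem sum_chargeFun (l : Core s) : ∑ i ∈ Finset.range s, chargeFun hs hst l i = 0 := by
  rw [← isMaya_belowSet_iff (by omega) hst (chargeFun_quasiPeriodic hs hst l),
    ← betaSet_eq_belowSet]
  exact isMaya_betaSet l.1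

theorem chargeFun_injective : Function.Injective (chargeFun hs hst) := fun l l' h =>
  Subtype.ext (betaSet_injective (by
    rw [betaSet_eq_belowSet hs hst, h, ← betaSet_eq_belowSet]))

/-- With `chargeFun_injective` and `sum_chargeFun`, this identifies `s`-cores with zero-sum
quasi-periodic functions. -/
theorem exists_chargeFun_eq {k : ℤ → ℤ} (hk : QuasiPeriodic s t k)
    (h0 : ∑ i ∈ Finset.range s, k i = 0) : ∃ l, chargeFun hs hst l = k := by
  obtain ⟨μ, hμ⟩ := ((isMaya_belowSet_iff (by omega) hst hk).2 h0).exists_betaSet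
  let l : Core s := ⟨μ, isCore_of_belowSet (by omega) hμ⟩
  refine ⟨l, ?_⟩
  refine belowSet_injective (by omega) hst (chargeFun_quasiPeriodic hs hst _) hk ?_
  exact (betaSet_eq_belowSet hs hst l).symm.trans hμ

theorem chargeFun_levelCore (w : AffineSymm s) (l : Core s) :
    chargeFun hs hst (levelCore hs hst w l) = fun i => chargeFun hs hst l (w⁻¹.1 i) := by
  refine belowSet_injective (by omega) hst (chargeFun_quasiPeriodic hs hst _)
    ((chargeFun_quasiPeriodic hs hst l).comp w⁻¹) ?_
  rw [← betaSet_eq_belowSet, ← levelAction_image_belowSet, ← betaSet_eq_belowSet]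
  exact betaSet_levelDiagram hs hst w l.1

theorem isCore_iff_antitone_chargeFun (ht : 0 < t) (l : Core s) :
    IsCore t l.1 ↔ Antitone (chargeFun hs hst l) := by
  rw [isCore_iff_antitone (by omega) ht hst (chargeFun_quasiPeriodic hs hst l)
    (betaSet_eq_belowSet hs hst l)]
  exact ⟨antitone_int_of_succ_le, fun h i => h (by omega)⟩

/-- Along a class modulo `s` the values of `k` differ by multiples of `t`, so `k` modulo `t`
descends to `ZMod s`. -/
theorem QuasiPeriodic.intCast_cast {s t : ℕ} {k : ℤ → ℤ} (hk : QuasiPeriodic s t k) (m : ℤ) :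
    (k ((m : ZMod s).cast : ℤ) : ZMod t) = k m := by
  obtain ⟨c, hc⟩ : (s : ℤ) ∣ ((m : ZMod s).cast : ℤ) - m := by
    rw [← ZMod.intCast_eq_intCast_iff_dvd_sub]; simp
  rw [← sub_add_cancel ((m : ZMod s).cast : ℤ) m, hc, add_comm, hk.add_mul]
  simp

/-- Freeness: the inverse translation sends `m` to some `m + s c`, which changes `k m` by `-t c`;
fixing the core forces `c = 0`. -/
theorem eq_one_of_levelCore_eq [NeZero t] {w : AffineSymm s} {l : Core s}
    (hw : residuePerm s w = 1) (h : levelCore hs hst w l = l) : w = 1 := by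
  rw [← inv_eq_one]
  ext m
  have h1 := congrFun (congrArg (chargeFun hs hst) h) m
  rw [chargeFun_levelCore] at h1
  change chargeFun hs hst l (w⁻¹.1 m) = _ at h1
  have h2 : ((w⁻¹.1 m : ℤ) : ZMod s) = m := by
    rw [← residuePerm_intCast, map_inv, hw]; simp
  rw [eq_comm, ZMod.intCast_eq_intCast_iff_dvd_sub] at h2
  obtain ⟨c, hc⟩ := h2
  have h3 := (chargeFun_quasiPeriodic hs hst l).add_mul m c
  rw [← hc, add_sub_cancel, h1] at h3
  have hc0 : c = 0 := (mul_eq_zero.1 (by linarith : (t : ℤ) * c = 0)).resolve_left (NeZero.ne _)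
  rw [hc0] at hc
  change w⁻¹.1 m = m
  linarith

/-! ### Reduction modulo `t` as the quotient by translations -/

variable [NeZero s]

/-- The reduction modulo `t` of the quasi-periodic function of an `s`-core. -/
noncomputable def reduction (l : Core s) : ZeroSum s t :=
  ⟨fun x => (chargeFun hs hst l (x.cast : ℤ) : ZMod t), by
    rw [← sum_range_intCast]
    simp only [(chargeFun_quasiPeriodic hs hst l).intCast_cast]
    rw [← Int.cast_sum, sum_chargeFun, Int.cast_zero]⟩

theorem reduction_intCast (l : Core s) (m : ℤ) :
    (reduction hs hst l).1 (m : ZMod s) = chargeFun hs hst l m :=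
  (chargeFun_quasiPeriodic hs hst l).intCast_cast m

theorem reduction_surjective [NeZero t] : Function.Surjective (reduction hs hst) := by
  intro y
  have hs' : (s : ℤ) ≠ 0 := NeZero.ne _
  obtain ⟨q, hq⟩ : (t : ℤ) ∣ ∑ x, ((y.1 x).val : ℤ) := by
    rw [← ZMod.intCast_zmod_eq_zero_iff_dvd]
    simpa using y.2
  -- Lift the values to `[0, t)`; their sum is `t q`, which is removed at the class `0` without
  -- changing the reduction. The term `-t (m / s)` below extends the lift quasi-periodically and
  -- vanishes on `0, …, s - 1`.
  let f : ZMod s → ℤ := fun x => (y.1 x).val - if x = 0 then t * q else 0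
  let k : ℤ → ℤ := fun m => f m - t * (m / s)
  have hk : QuasiPeriodic s t k := fun m => by
    simp only [k, Int.cast_add, Int.cast_natCast, CharP.cast_eq_zero, add_zero]
    rw [Int.add_ediv_of_dvd_right (dvd_refl _), Int.ediv_self hs']
    ring
  have h0 : ∑ i ∈ Finset.range s, k i = 0 := by
    have h1 : ∀ i ∈ Finset.range s, k i = f ((i : ℤ) : ZMod s) := fun i hi => by
      simp only [k]
      rw [Int.ediv_eq_zero_of_lt (by omega) (by have := Finset.mem_range.1 hi; omega)]
      ring
    rw [Finset.sum_congr rfl h1, sum_range_intCast f, Finset.sum_sub_distrib, hq]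
    simp
  obtain ⟨l, hl⟩ := exists_chargeFun_eq hs hst hk h0
  refine ⟨l, Subtype.ext (funext fun x => ?_)⟩
  obtain ⟨m, rfl⟩ := ZMod.intCast_surjective x
  rw [reduction_intCast, hl]
  simp only [k, f]
  split_ifs <;> simp

theorem reduction_levelCore (w : AffineSymm s) (l : Core s) :
    reduction hs hst (levelCore hs hst w l) = residuePerm s w • reduction hs hst l := by
  refine Subtype.ext (funext fun x => ?_)
  obtain ⟨m, rfl⟩ := ZMod.intCast_surjective x
  rw [ZeroSum.smul_apply, ← map_inv, residuePerm_intCast, reduction_intCast, reduction_intCast,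
    chargeFun_levelCore]

/-- The two functions differ by `t z` with `z` periodic of period `s` and of sum zero over a period.
The translation `m ↦ m + s z m` therefore lies in the group, and `k (m - s z m) = k m + t z m`. -/
theorem exists_translation_of_reduction_eq [NeZero t] {l l' : Core s}
    (h : reduction hs hst l = reduction hs hst l') :
    ∃ w, residuePerm s w = 1 ∧ levelCore hs hst w l = l' := by
  have hk := chargeFun_quasiPeriodic hs hst l
  have hk' := chargeFun_quasiPeriodic hs hst l'
  have ht' : (t : ℤ) ≠ 0 := NeZero.ne _
  have hdvd : ∀ m, ∃ z, chargeFun hs hst l' m - chargeFun hs hst l m = t * z := by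
    intro m
    have h1 := congrFun (congrArg Subtype.val h) (m : ZMod s)
    rw [reduction_intCast, reduction_intCast, ZMod.intCast_eq_intCast_iff_dvd_sub] at h1
    exact h1
  choose z hz using hdvd
  have hper : ∀ m, z (m + s) = z m := fun m => by
    apply mul_left_cancel₀ ht'
    rw [← hz, ← hz, hk, hk']
    ring
  have hper' : ∀ m a, z (m + s * a) = z m := fun m a => by
    rw [mul_comm]
    exact (show Function.Periodic z (s : ℤ) from hper).int_mul a m
  let w : Equiv.Perm ℤ :=
    { toFun := fun m => m + s * z m
      invFun := fun m => m + s * -z m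
      left_inv := fun m => by simp only [hper']; ring
      right_inv := fun m => by simp only [hper']; ring }
  have hw : w ∈ AffineSymm s := by
    refine ⟨fun m => ?_, ?_⟩
    · change m + s + s * z (m + s) = m + s * z m + s
      rw [hper]; ring
    · rw [← sum_sub_eq_zero_iff s (fun m => w m)]
      have h1 : ∀ i : ℕ, w i - i = s * z i := fun i => add_sub_cancel_left _ _
      rw [Finset.sum_congr rfl fun i _ => h1 i, ← Finset.mul_sum]
      have h2 : (t : ℤ) * ∑ i ∈ Finset.range s, z i = 0 := by
        rw [Finset.mul_sum, Finset.sum_congr rfl fun (i : ℕ) _ => (hz i).symm, Finset.sum_sub_distrib,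
          sum_chargeFun, sum_chargeFun, sub_zero]
      rw [(mul_eq_zero.1 h2).resolve_left ht', mul_zero]
  refine ⟨⟨w, hw⟩, ?_, ?_⟩
  · ext x
    obtain ⟨m, rfl⟩ := ZMod.intCast_surjective x
    rw [residuePerm_intCast]
    change ((m + s * z m : ℤ) : ZMod s) = m
    simp
  · apply chargeFun_injective hs hst
    rw [chargeFun_levelCore]
    funext m
    change chargeFun hs hst l (m + s * -z m) = _
    rw [hk.add_mul]
    linarith [hz m]

end Charge

end AffineCores

open AffineCores in
theorem mainTheorem1 (s t : ℕ) (hs : 2 ≤ s) (hst : s.Coprime t) :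
    {l : Core s | IsCore t l.1}.Finite ∧
    (∀ l : Core s, IsCore t l.1 → Finite (levelStab hs hst l)) ∧
    ∑ᶠ l ∈ {l : Core s | IsCore t l.1}, (1 : ℚ) / (Nat.card (levelStab hs hst l) : ℚ) =
      (t : ℚ) ^ (s - 1) / (s ! : ℚ) := by
  have ht : 0 < t := by
    rcases Nat.eq_zero_or_pos t with rfl | h
    · rw [Nat.coprime_zero_right] at hst; omega
    · exact h
  have : NeZero s := ⟨by omega⟩
  have : NeZero t := ⟨ht.ne'⟩
  have hcore := isCore_iff_antitone_chargeFun hs hst ht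
  obtain ⟨h1, h2, h3⟩ := finsum_inv_card_stabilizer (levelCore hs hst) (residuePerm s)
    residuePerm_surjective (reduction hs hst) (reduction_surjective hs hst)
    (reduction_levelCore hs hst) (fun _ _ => exists_translation_of_reduction_eq hs hst)
    (fun _ _ => eq_one_of_levelCore_eq hs hst) {l : Core s | IsCore t l.1}
    (fun l => by
      obtain ⟨w, hw⟩ := exists_antitone hs ht (chargeFun_quasiPeriodic hs hst l)
      -- The action precomposes with the inverse, so the element that sorts `k` by `k ∘ w` is `w⁻¹`.
      refine ⟨w⁻¹, (hcore _).2 ?_⟩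
      rw [chargeFun_levelCore, inv_inv]
      exact antitone_int_of_succ_le hw)
    (fun l hl w hw => by
      have hl' := (hcore _).1 hl
      have hw' := (hcore _).1 hw
      apply chargeFun_injective hs hst
      rw [chargeFun_levelCore] at hw' ⊢
      exact comp_eq_of_antitone (by omega) ht (chargeFun_quasiPeriodic hs hst l) w⁻¹ hl' hw')
  refine ⟨h1, fun l _ => h2 l, h3.trans ?_⟩
  rw [card_zeroSum, Nat.card_eq_fintype_card, Fintype.card_perm, ZMod.card, Nat.cast_pow]
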